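/- Let $(X,\mu)$ be a standard non-atomic probability space, and let $R$ be a measured equivalence relation on $X$: $R\subset X\times X$ is Borel, has countable classes, and the saturation of every null set is null. A partial automorphism of $R$ is a Borel isomorphism $\varphi:A\to B$ between Borel subsets of $X$ whose graph is contained in $R$; $[R]$ is the group of those with $A=B=X$. Suppose that $R$ is of type $\mathrm{II}_1$ ($\mu$ is invariant under all partial automorphisms of $R$) and ergodic (every $R$-saturated measurable set has measure $0$ or $1$). A graphing of $R$ is a measurable set $K\subset R$ such that, for almost every $x$, every $y$ with $(x,y)\in R$ is joined to $x$ by a finite chain of elements of $K\cup K^{-1}$; a countable family $\Phi=\{\varphi_i\}$ of partial automorphisms is a graphing if the union of the graphs is one. The cost of $R$ is $C(R)=\inf_\Phi\sum_i\mu(\mathrm{dom}\,\varphi_i)$, over all such families $\Phi$ that are graphings of $R$. A graphing $K$ is finite if it can be partitioned into finitely many (graphs of) partial automorphisms of $R$. For a finite graphing $K$ and a finite nonempty set $A\subset[R]$ whose elements pairwise differ at almost every point, put $A^x=\{\varphi(x):\varphi\in A\}$, let $\partial_KA^x$ be the set of pairs $(y,z)\in K$ with $y,z$ in the $R$-class of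 $x$ and exactly one of $y,z$ in $A^x$, and set $$h_K(R)=\inf_A\frac1{|A|}\int_X|\partial_KA^x|\,d\mu(x),\qquad h(R)=\inf_K h_K(R),$$ the last infimum being over all finite graphings $K$ of $R$ (with $\inf\emptyset=+\infty$). If $C(R)=1$, then $h(R)=0$; in particular, $R$ has a finite graphing. -/

import Mathlib

open MeasureTheory
open scoped ENNReal

namespace MeasuredEqRel

variable {X : Type*} [MeasurableSpace X]

/-- A measured equivalence relation on `(X, μ)`: its classes are countable, its graph is a Borel
subset of `X × X`, and the saturation of a null set is a null set. -/
structure IsMeasured (R : Setoid X) (μ : Measure X) : Prop where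
  countable_classes : ∀ x, {y | R.r x y}.Countable
  measurableSet_graph : MeasurableSet {p : X × X | R.r p.1 p.2}
  null_saturation : ∀ N : Set X, μ N = 0 → μ {y | ∃ x ∈ N, R.r x y} = 0

/-- Ergodicity: every saturated measurable set has measure `0` or `1`. -/
def IsErgodic (R : Setoid X) (μ : Measure X) : Prop :=
  ∀ E : Set X, MeasurableSet E → (∀ x y, R.r x y → x ∈ E → y ∈ E) → μ E = 0 ∨ μ E = 1

/-- A partial automorphism of `R`: a Borel isomorphism between two Borel subsets of `X` whose
graph is included in `R`. -/
structure PartialAut (R : Setoid X) where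
  dom : Set X
  cod : Set X
  measurableSet_dom : MeasurableSet dom
  measurableSet_cod : MeasurableSet cod
  toEquiv : dom ≃ᵐ cod
  rel : ∀ x : dom, R.r (x : X) (toEquiv x : X)

/-- The graph `{(x, φ x) : x ∈ dom φ}` of a partial automorphism. -/
def PartialAut.graph {R : Setoid X} (φ : PartialAut R) : Set (X × X) :=
  {p | ∃ x : φ.dom, p = ((x : X), (φ.toEquiv x : X))}

/-- The image `φ(E ∩ dom φ)` of a set `E`. -/
def PartialAut.image {R : Setoid X} (φ : PartialAut R) (E : Set X) : Set X :=
  {y | ∃ x : φ.dom, (x : X) ∈ E ∧ (φ.toEquiv x : X) = y}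

/-- `R` is of type `II₁`: the measure `μ` is invariant under every partial automorphism of `R`. -/
def IsTypeII1 (R : Setoid X) (μ : Measure X) : Prop :=
  ∀ (φ : PartialAut R) (E : Set X), MeasurableSet E → E ⊆ φ.dom → μ (φ.image E) = μ E

/-- A graphing of `R`, as a measurable subset `K` of `R`: up to a null set, any two equivalent
points are joined by a finite chain of elements of `K` and of inverses of elements of `K`. -/
structure IsGraphing (R : Setoid X) (μ : Measure X) (K : Set (X × X)) : Prop where
  measurableSet : MeasurableSet K
  subset : ∀ p ∈ K, R.r p.1 p.2
  generates : ∀ᵐ x ∂μ, ∀ y, R.r x y → Relation.EqvGen (fun a b => (a, b) ∈ K) x y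

/-- A graphing of `R`, as a countable family of partial automorphisms; a family with finitely many
members is one in which the other domains are empty. -/
def IsGraphingFamily (R : Setoid X) (μ : Measure X) (Φ : ℕ → PartialAut R) : Prop :=
  IsGraphing R μ (⋃ i, (Φ i).graph)

/-- The cost `∑ μ(dom φᵢ)` of a countable family of partial automorphisms. -/
noncomputable def familyCost {R : Setoid X} (μ : Measure X) (Φ : ℕ → PartialAut R) : ℝ≥0∞ :=
  ∑' i, μ (Φ i).dom

/-- The cost of `R`: the infimum of the costs of its graphings. -/
noncomputable def cost (R : Setoid X) (μ : Measure X) : ℝ≥0∞ :=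
  ⨅ (Φ : ℕ → PartialAut R) (_ : IsGraphingFamily R μ Φ), familyCost μ Φ

/-- A finite graphing: one that can be partitioned into finitely many partial automorphisms. -/
def IsFiniteGraphing (R : Setoid X) (μ : Measure X) (K : Set (X × X)) : Prop :=
  IsGraphing R μ K ∧ ∃ (n : ℕ) (φ : Fin n → PartialAut R),
    (Pairwise fun i j => Disjoint (φ i).graph (φ j).graph) ∧ K = ⋃ i, (φ i).graph

/-- The edges of the Cayley graph of `R` associated to `K`. Its vertices are the elements of `R`,
the vertices of the fibre over `x` being the pairs `(x, y)`; its edges are the pairs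
`((x, y), (x, z))` of vertices in the same fibre with `(y, z) ∈ K`. -/
def cayleyEdges (R : Setoid X) (K : Set (X × X)) : Set ((X × X) × (X × X)) :=
  {e | e.1.1 = e.2.1 ∧ R.r e.1.1 e.1.2 ∧ R.r e.2.1 e.2.2 ∧ (e.1.2, e.2.2) ∈ K}

/-- The measure `ν⁽¹⁾(E) = ∫ |E ∩ Σˣ| dμ(x)` on the edges of the Cayley graph. -/
noncomputable def edgeMeasure (μ : Measure X) (E : Set ((X × X) × (X × X))) : ℝ≥0∞ :=
  ∫⁻ x, (({e ∈ E | e.1.1 = x}.encard : ℕ∞) : ℝ≥0∞) ∂μ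

/-- The group `[R]` of automorphisms of `R`. A symmetric vertex of the Cayley graph is the graph
of such an automorphism, and is represented by it. -/
def fullGroup (R : Setoid X) : Set (X ≃ᵐ X) :=
  {φ | ∀ x, R.r x (φ x)}

/-- The set of vertices `(x, φ x)`, `φ ∈ A`, covered by a finite set `A` of symmetric vertices. -/
def vertexSet (A : Finset (X ≃ᵐ X)) : Set (X × X) :=
  {v | ∃ φ ∈ A, v.2 = φ v.1}

/-- The edge boundary of `A`: edges with one vertex in `A` and the other one outside of `A`. -/
def edgeBoundary (R : Setoid X) (K : Set (X × X)) (A : Finset (X ≃ᵐ X)) :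
    Set ((X × X) × (X × X)) :=
  {e ∈ cayleyEdges R K | Xor (e.1 ∈ vertexSet A) (e.2 ∈ vertexSet A)}

/-- A nonempty finite set of pairwise disjoint symmetric vertices; disjoint means that the graphs
have null intersection, that is, the two automorphisms differ at almost every point. -/
structure IsSymmetricFamily (R : Setoid X) (μ : Measure X) (A : Finset (X ≃ᵐ X)) : Prop where
  nonempty : A.Nonempty
  mem_fullGroup : ∀ φ ∈ A, φ ∈ fullGroup R
  pairwise_disjoint : ∀ φ ∈ A, ∀ ψ ∈ A, φ ≠ ψ → ∀ᵐ x ∂μ, φ x ≠ ψ x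

/-- The isoperimetric constant `h_K(R)` of `R` with respect to `K`. -/
noncomputable def isoperimetricConstant (R : Setoid X) (μ : Measure X) (K : Set (X × X)) : ℝ≥0∞ :=
  ⨅ (A : Finset (X ≃ᵐ X)) (_ : IsSymmetricFamily R μ A),
    edgeMeasure μ (edgeBoundary R K A) / (A.card : ℝ≥0∞)

/-- The uniform isoperimetric constant `h(R)`: the infimum of `h_K(R)` over all finite graphings
`K` of `R` (so it is `∞` if `R` has no finite graphing). -/
noncomputable def uniformIsoperimetricConstant (R : Setoid X) (μ : Measure X) : ℝ≥0∞ :=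
  ⨅ (K : Set (X × X)) (_ : IsFiniteGraphing R μ K), isoperimetricConstant R μ K

end MeasuredEqRel

/-! A graphing of cost close to `1` is almost a tree, and a tree can be traded for a finite group
action whose orbits have no boundary of their own.

Fix `N` large and a graphing of cost at most `1 + δ`. By ergodicity and invariance, `R` contains an
almost free action `T` of `ℤ/N` with a set `A` of measure `1/N` that meets almost every orbit
(`IsCover.exists_action`). In the graphing, almost every point outside `A` chooses an edge bringing
it closer to `A`. These edges form a forest of total measure `1 - 1/N`, and contracting it retracts
`X` onto `A` (`IsDoubled.exists_contraction`). The surplus edges have measure at most `m = δ + 1/N`;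
once their endpoints are retracted, they generate `R` on `A`, so together with `T` they generate
`R`.

The retracted surplus edges need not form finitely many partial automorphisms. Their sources are
therefore packed disjointly into a set `P` of measure at most `m` (`IsCover.exists_packing`), and
each surplus edge is replaced by the two maps from its point of `P` to the retracted endpoints. Each
of these maps is generated by two partial automorphisms whose domains partition `P`
(`IsCover.exists_chain`). With `T`, this is a finite graphing `K`.

Take the maps of `T` as symmetric family. Edges of `T` never leave an orbit, so only the four other
maps, of total measure at most `2m`, contribute to the boundary. Invariance bounds it by `N · 4m`
(`edgeMeasure_edgeBoundary_le`). Hence `h(R) ≤ 4m`, which is arbitrarily small. -/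

namespace MeasuredEqRel

open Set

/-! ### Partial automorphisms, measurable selection, and countable covers of `R`. -/

section

variable {X : Type*} [MeasurableSpace X]

/-- A measurable map `f`, injective on the measurable set `D`, and moving the points of `D` inside
their `R`-classes. Up to packaging, the restriction of `f` to `D` is a partial automorphism. -/
structure IsPartial (R : Setoid X) (f : X → X) (D : Set X) : Prop where
  measurable : Measurable f
  measurableSet : MeasurableSet D
  injOn : InjOn f D
  rel : ∀ x ∈ D, R.r x (f x)

namespace IsPartial

variable {R : Setoid X} {f g : X → X} {D E : Set X}

lemma mono (h : IsPartial R f D) (hE : MeasurableSet E) (hED : E ⊆ D) : IsPartial R f E :=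
  ⟨h.measurable, hE, h.injOn.mono hED, fun x hx => h.rel x (hED hx)⟩

lemma comp (hg : IsPartial R g E) (hf : IsPartial R f D) :
    IsPartial R (g ∘ f) (D ∩ f ⁻¹' E) :=
  ⟨hg.measurable.comp hf.measurable, hf.measurableSet.inter (hf.measurable hg.measurableSet),
    fun _ hx _ hy h => hf.injOn hx.1 hy.1 (hg.injOn hx.2 hy.2 h),
    fun x hx => R.trans (hf.rel x hx.1) (hg.rel _ hx.2)⟩

lemma id_univ : IsPartial R id univ :=
  ⟨measurable_id, .univ, injOn_id _, fun x _ => R.refl x⟩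

variable [StandardBorelSpace X]

lemma measurableSet_image (h : IsPartial R f D) (hE : MeasurableSet E) (hED : E ⊆ D) :
    MeasurableSet (f '' E) :=
  hE.image_of_measurable_injOn h.measurable (h.injOn.mono hED)

/-- The inverse is measurable by the Lusin–Souslin theorem: an injective Borel map on a standard
Borel space is a measurable embedding. -/
lemma exists_partialAut (h : IsPartial R f D) :
    ∃ φ : PartialAut R, φ.dom = D ∧ φ.graph = {p | p.1 ∈ D ∧ p.2 = f p.1} ∧
      ∀ E ⊆ D, φ.image E = f '' E := by
  have hbij : Function.Bijective (fun x : D => (⟨f x, mem_image_of_mem f x.2⟩ : f '' D)) := by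
    refine ⟨fun x y hxy => Subtype.ext (h.injOn x.2 y.2 (congrArg Subtype.val hxy)), ?_⟩
    rintro ⟨_, x, hx, rfl⟩
    exact ⟨⟨x, hx⟩, rfl⟩
  have hmeas : Measurable (fun x : D => (⟨f x, mem_image_of_mem f x.2⟩ : f '' D)) :=
    (h.measurable.comp measurable_subtype_coe).subtype_mk
  let e : D ≃ᵐ f '' D :=
    { Equiv.ofBijective _ hbij with
      measurable_toFun := hmeas
      measurable_invFun := by
        intro s hs
        have := h.measurableSet.standardBorel
        have h1 := (hmeas.measurableEmbedding hbij.1).measurableSet_image' hs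
        convert! h1 using 1
        exact ((Equiv.ofBijective _ hbij).image_eq_preimage_symm s).symm }
  refine ⟨⟨D, f '' D, h.measurableSet, h.measurableSet_image h.measurableSet le_rfl, e,
    fun x => h.rel x x.2⟩, rfl, ?_, ?_⟩
  · ext ⟨x, y⟩
    constructor
    · rintro ⟨x', hx'⟩
      obtain ⟨rfl, rfl⟩ := Prod.mk.inj hx'
      exact ⟨x'.2, rfl⟩
    · rintro ⟨hx, hy⟩
      exact ⟨⟨x, hx⟩, Prod.ext rfl hy⟩
  · intro E hE
    ext y
    constructor
    · rintro ⟨x, hx, rfl⟩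
      exact ⟨x, hx, rfl⟩
    · rintro ⟨x, hx, rfl⟩
      exact ⟨⟨x, hE hx⟩, hx, rfl⟩

lemma measure_image {μ : Measure X} (hII : IsTypeII1 R μ) (h : IsPartial R f D)
    (hE : MeasurableSet E) (hED : E ⊆ D) : μ (f '' E) = μ E := by
  obtain ⟨φ, hdom, -, himg⟩ := h.exists_partialAut
  rw [← himg E hED]
  exact hII φ E hE (hdom ▸ hED)

lemma measurableSet_graph (h : IsPartial R f D) : MeasurableSet {p : X × X | p.1 ∈ D ∧ p.2 = f p.1} :=
  (measurable_fst h.measurableSet).inter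
    (measurableSet_eq_fun measurable_snd (h.measurable.comp measurable_fst))

end IsPartial

section

variable {R : Setoid X}

/-- Both maps are extended by the identity, so that later arguments compose total functions instead
of maps between subtypes. -/
lemma PartialAut.exists_isPartial (φ : PartialAut R) :
    ∃ f f' : X → X, IsPartial R f φ.dom ∧ IsPartial R f' φ.cod ∧
      (∀ x ∈ φ.dom, f x ∈ φ.cod ∧ f' (f x) = x) ∧ (∀ y ∈ φ.cod, f' y ∈ φ.dom ∧ f (f' y) = y) ∧
      φ.graph = {p | p.1 ∈ φ.dom ∧ p.2 = f p.1} := by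
  classical
  let f : X → X := fun x => if hx : x ∈ φ.dom then (φ.toEquiv ⟨x, hx⟩ : X) else x
  let f' : X → X := fun x => if hx : x ∈ φ.cod then (φ.toEquiv.symm ⟨x, hx⟩ : X) else x
  have hf : ∀ x (hx : x ∈ φ.dom), f x = φ.toEquiv ⟨x, hx⟩ := fun x hx => dif_pos hx
  have hf' : ∀ x (hx : x ∈ φ.cod), f' x = φ.toEquiv.symm ⟨x, hx⟩ := fun x hx => dif_pos hx
  have hff : ∀ x ∈ φ.dom, f x ∈ φ.cod ∧ f' (f x) = x := by
    intro x hx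
    have h1 : f x ∈ φ.cod := by rw [hf x hx]; exact Subtype.coe_prop _
    refine ⟨h1, ?_⟩
    rw [hf' _ h1]
    have : (⟨f x, h1⟩ : φ.cod) = φ.toEquiv ⟨x, hx⟩ := Subtype.ext (hf x hx)
    simp [this]
  have hff' : ∀ y ∈ φ.cod, f' y ∈ φ.dom ∧ f (f' y) = y := by
    intro x hx
    have h1 : f' x ∈ φ.dom := by rw [hf' x hx]; exact Subtype.coe_prop _
    refine ⟨h1, ?_⟩
    rw [hf _ h1]
    have : (⟨f' x, h1⟩ : φ.dom) = φ.toEquiv.symm ⟨x, hx⟩ := Subtype.ext (hf' x hx)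
    simp [this]
  refine ⟨f, f', ⟨?_, φ.measurableSet_dom, ?_, ?_⟩, ⟨?_, φ.measurableSet_cod, ?_, ?_⟩,
    hff, hff', ?_⟩
  · exact Measurable.dite (measurable_subtype_coe.comp φ.toEquiv.measurable)
      measurable_subtype_coe φ.measurableSet_dom
  · intro x hx y hy hxy
    rw [← (hff x hx).2, hxy, (hff y hy).2]
  · intro x hx
    rw [hf x hx]
    exact φ.rel ⟨x, hx⟩
  · exact Measurable.dite (measurable_subtype_coe.comp φ.toEquiv.symm.measurable)
      measurable_subtype_coe φ.measurableSet_cod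
  · intro x hx y hy hxy
    rw [← (hff' x hx).2, hxy, (hff' y hy).2]
  · intro x hx
    have := φ.rel (φ.toEquiv.symm ⟨x, hx⟩)
    rw [hf' x hx]
    simpa using R.symm this
  · ext ⟨x, y⟩
    constructor
    · rintro ⟨x', hx'⟩
      obtain ⟨rfl, rfl⟩ := Prod.mk.inj hx'
      exact ⟨x'.2, (hf _ x'.2).symm⟩
    · rintro ⟨hx, hy⟩
      exact ⟨⟨x, hx⟩, Prod.ext rfl (hy.trans (hf x hx))⟩

/-- Measurable choice of an index among countably many measurable conditions. -/
lemma exists_measurable_index {Y ι : Type*} [MeasurableSpace Y] [Encodable ι] [Nonempty ι]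
    [MeasurableSpace ι] (V : ι → Set Y) (hV : ∀ i, MeasurableSet (V i)) :
    ∃ ν : Y → ι, Measurable ν ∧ ∀ y i, y ∈ V i → y ∈ V (ν y) := by
  classical
  let i₀ : ι := Classical.arbitrary ι
  let p : Y → ℕ → Prop := fun y n => y ∈ ⋃ i ∈ Encodable.decode₂ ι n, V i
  have hpm : ∀ n, MeasurableSet {y | p y n} := fun n =>
    MeasurableSet.iUnion fun i => MeasurableSet.iUnion fun _ => hV i
  -- The second alternative lets `Nat.find` be defined also at the points where no condition holds.
  let q : Y → ℕ → Prop := fun y n => p y n ∨ ∀ m, ¬ p y m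
  have hq : ∀ y, ∃ n, q y n := by
    intro y
    by_cases h : ∃ n, p y n
    · exact h.imp fun n hn => Or.inl hn
    · exact ⟨0, Or.inr (not_exists.1 h)⟩
  have hqm : ∀ n, MeasurableSet {y | q y n} := by
    intro n
    have h := (hpm n).union (MeasurableSet.iInter fun m => (hpm m).compl)
    convert! h using 1
    ext y
    simp [q]
  refine ⟨fun y => (Encodable.decode₂ ι (Nat.find (hq y))).getD i₀, ?_, ?_⟩
  · exact (measurable_from_nat (f := fun n => (Encodable.decode₂ ι n).getD i₀)).comp
      (measurable_find hq hqm)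
  · intro y i hi
    have h1 : p y (Encodable.encode i) := by simp [p, hi]
    have h2 := Nat.find_spec (hq y)
    rcases h2 with h2 | h2
    · simp only [p, mem_iUnion] at h2
      obtain ⟨j, hj, hy⟩ := h2
      have hj' : Encodable.decode₂ ι (Nat.find (hq y)) = some j := hj
      simpa [hj'] using hy
    · exact absurd h1 (h2 _)

/-- Used with `exists_measurable_index` to glue countably many maps along a measurable choice; the
selections below are of this kind. -/
lemma measurable_apply_index {Y Z ι : Type*} [MeasurableSpace Y] [MeasurableSpace Z] [Countable ι]
    [MeasurableSpace ι] [MeasurableSingletonClass ι] {g : ι → Y → Z} (hg : ∀ i, Measurable (g i))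
    {ν : Y → ι} (hν : Measurable ν) : Measurable fun y => g (ν y) y :=
  (measurable_from_prod_countable_left (f := fun p : Y × ι => g p.2 p.1) hg).comp
    (measurable_id.prodMk hν)

/-- A countable family of partial automorphisms whose graphs cover `R` on a conull saturated
set `S`. -/
structure IsCover (R : Setoid X) (μ : Measure X) (g : ℕ → X → X) (C : ℕ → Set X)
    (S : Set X) : Prop where
  isPartial : ∀ i, IsPartial R (g i) (C i)
  measurableSet : MeasurableSet S
  conull : μ Sᶜ = 0
  saturated : ∀ x ∈ S, ∀ y, R.r x y → y ∈ S
  exists_eq : ∀ x ∈ S, ∀ y, R.r x y → ∃ i, x ∈ C i ∧ g i x = y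

/-- The composition of the maps of `F` along a word. -/
def wordMap {κ Z : Type*} (F : κ → Z → Z) : List κ → Z → Z
  | [] => id
  | j :: w => wordMap F w ∘ F j

/-- The points at which the composition along a word is defined. -/
def wordDom {κ Z : Type*} (F : κ → Z → Z) (C : κ → Set Z) : List κ → Set Z
  | [] => univ
  | j :: w => C j ∩ F j ⁻¹' wordDom F C w

lemma isPartial_word {κ : Type*} {F : κ → X → X} {C : κ → Set X}
    (h : ∀ j, IsPartial R (F j) (C j)) (w : List κ) :
    IsPartial R (wordMap F w) (wordDom F C w) := by
  induction w with
  | nil => exact IsPartial.id_univ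
  | cons j w ih => exact ih.comp (h j)

lemma exists_word {κ Z : Type*} {F : κ → Z → Z} {C : κ → Set Z} {r : Z → Z → Prop}
    (hr : ∀ x y, r x y → ∃ j, x ∈ C j ∧ F j x = y) {x y : Z} (hxy : Relation.ReflTransGen r x y) :
    ∃ w, x ∈ wordDom F C w ∧ wordMap F w x = y := by
  induction hxy using Relation.ReflTransGen.head_induction_on with
  | refl => exact ⟨[], mem_univ _, rfl⟩
  | head hab _ ih =>
    obtain ⟨w, hw, rfl⟩ := ih
    obtain ⟨j, hj, rfl⟩ := hr _ _ hab
    exact ⟨j :: w, ⟨hj, hw⟩, rfl⟩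

/-- Enough partial maps to describe a graphing family: `F (i, true)` is the `i`-th map, of domain
`C (i, true)`, and `F (i, false)` is its inverse. -/
structure IsDoubled (R : Setoid X) (F : ℕ × Bool → X → X) (C : ℕ × Bool → Set X) : Prop where
  isPartial : ∀ j, IsPartial R (F j) (C j)
  mapsTo : ∀ i b, ∀ x ∈ C (i, b), F (i, b) x ∈ C (i, !b)
  inv : ∀ i b, ∀ x ∈ C (i, b), F (i, !b) (F (i, b) x) = x

/-- The edge relation of the family. -/
def doubledEdge (F : ℕ × Bool → X → X) (C : ℕ × Bool → Set X) (x y : X) : Prop :=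
  ∃ i, x ∈ C (i, true) ∧ y = F (i, true) x

lemma exists_doubled (Φ : ℕ → PartialAut R) :
    ∃ (F : ℕ × Bool → X → X) (C : ℕ × Bool → Set X), IsDoubled R F C ∧
      (∀ i, C (i, true) = (Φ i).dom) ∧
      (∀ x y, (x, y) ∈ (⋃ i, (Φ i).graph) ↔ doubledEdge F C x y) := by
  choose f f' hf hf' h h' hg using fun i => (Φ i).exists_isPartial
  refine ⟨fun j => if j.2 then f j.1 else f' j.1,
    fun j => if j.2 then (Φ j.1).dom else (Φ j.1).cod, ⟨?_, ?_, ?_⟩, ?_, ?_⟩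
  · rintro ⟨i, _ | _⟩
    · exact hf' i
    · exact hf i
  · rintro i (_ | _) x hx
    · exact (h' i x hx).1
    · exact (h i x hx).1
  · rintro i (_ | _) x hx
    · exact (h' i x hx).2
    · exact (h i x hx).2
  · intro i; rfl
  · intro x y
    simp only [mem_iUnion, hg, doubledEdge]
    rfl

/-- Words in the maps and their inverses are countably many and reach every point of a class. The
graphing itself thus provides the cover, without the Feldman–Moore theorem. -/
lemma IsDoubled.exists_cover {μ : Measure X} (hR : IsMeasured R μ) {F : ℕ × Bool → X → X}
    {C : ℕ × Bool → Set X} (hF : IsDoubled R F C)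
    (hgen : ∀ᵐ x ∂μ, ∀ y, R.r x y → Relation.EqvGen (doubledEdge F C) x y) :
    ∃ g D S, IsCover R μ g D S ∧
      ∀ x ∈ S, ∀ y, R.r x y → Relation.EqvGen (doubledEdge F C) x y := by
  have hword : ∀ x y, Relation.EqvGen (doubledEdge F C) x y →
      ∃ w, x ∈ wordDom F C w ∧ wordMap F w x = y := by
    intro x y hxy
    rw [← Relation.EqvGen.reflTransGen_symmGen] at hxy
    refine exists_word (fun x y h => ?_) hxy
    rcases h with ⟨i, hi, rfl⟩ | ⟨i, hi, rfl⟩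
    · exact ⟨(i, true), hi, rfl⟩
    · exact ⟨(i, false), hF.mapsTo i true _ hi, hF.inv i true _ hi⟩
  have hpart := isPartial_word hF.isPartial
  obtain ⟨N, hN, hNm, hN0⟩ := exists_measurable_superset_of_null (ae_iff.1 hgen)
  have hgood : ∀ x ∉ N, ∀ y, R.r x y → Relation.EqvGen (doubledEdge F C) x y := by
    intro x hx
    by_contra hcon
    exact hx (hN hcon)
  -- The points led into `N` by some word: a measurable substitute for the saturation of `N`, null
  -- because it is contained in that saturation.
  let M : Set X := ⋃ w, wordDom F C w ∩ wordMap F w ⁻¹' N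
  have hMm : MeasurableSet M := MeasurableSet.iUnion fun w =>
    (hpart w).measurableSet.inter ((hpart w).measurable hNm)
  have hNM : N ⊆ M := fun x hx => mem_iUnion.2 ⟨[], mem_univ _, hx⟩
  have hM0 : μ M = 0 := by
    refine measure_mono_null ?_ (hR.null_saturation N hN0)
    intro x hx
    obtain ⟨w, hw, hx⟩ := mem_iUnion.1 hx
    exact ⟨_, hx, R.symm ((hpart w).rel x hw)⟩
  have hgood' : ∀ x ∈ Mᶜ, ∀ y, R.r x y → Relation.EqvGen (doubledEdge F C) x y :=
    fun x hx => hgood x fun h => hx (hNM h)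
  refine ⟨fun n => (Encodable.decode₂ (List (ℕ × Bool)) n).elim id (wordMap F),
    fun n => (Encodable.decode₂ (List (ℕ × Bool)) n).elim ∅ (wordDom F C), Mᶜ,
    ⟨fun n => ?_, hMm.compl, by simpa using hM0, ?_, ?_⟩, hgood'⟩
  · cases Encodable.decode₂ (List (ℕ × Bool)) n with
    | none => exact IsPartial.id_univ.mono .empty (empty_subset _)
    | some w => exact hpart w
  · intro x hx y hxy hy
    obtain ⟨w, hw, hy⟩ := mem_iUnion.1 hy
    have hz := (hpart w).rel y hw
    obtain ⟨v, hv, hv'⟩ := hword x _ (hgood' x hx _ (R.trans hxy hz))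
    refine hx (mem_iUnion.2 ⟨v, hv, ?_⟩)
    rw [mem_preimage, hv']
    exact hy
  · intro x hx y hxy
    obtain ⟨w, hw⟩ := hword x y (hgood' x hx y hxy)
    exact ⟨Encodable.encode w, by simpa using hw⟩

end

end

/-! ### Consequences of ergodicity: packings and sets of prescribed measure. -/

section

variable {X : Type*} [MeasurableSpace X]

/-- In an ergodic relation, almost every point is equivalent to a point of a given non-null set. -/
lemma IsCover.ae_exists_rel {R : Setoid X} {μ : Measure X} [IsProbabilityMeasure μ]
    {g : ℕ → X → X} {C : ℕ → Set X} {S : Set X} (hc : IsCover R μ g C S)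
    (herg : IsErgodic R μ) {P : Set X} (hP : MeasurableSet P) (hP0 : μ P ≠ 0) :
    ∀ᵐ x ∂μ, ∃ y ∈ P, R.r x y := by
  -- Intersecting with `S` makes the set invariant at every point, as `IsErgodic` requires.
  let B : Set X := (⋃ n, C n ∩ g n ⁻¹' P) ∩ S
  have hB : MeasurableSet B := (MeasurableSet.iUnion fun n =>
    (hc.isPartial n).measurableSet.inter ((hc.isPartial n).measurable hP)).inter hc.measurableSet
  have hBR : ∀ x ∈ B, ∃ y ∈ P, R.r x y := by
    rintro x ⟨hx, -⟩
    obtain ⟨n, hn, hx⟩ := mem_iUnion.1 hx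
    exact ⟨_, hx, (hc.isPartial n).rel x hn⟩
  have hRB : ∀ x ∈ S, ∀ y ∈ P, R.r x y → x ∈ B := by
    intro x hx y hy hxy
    obtain ⟨n, hn, rfl⟩ := hc.exists_eq x hx y hxy
    exact ⟨mem_iUnion.2 ⟨n, hn, hy⟩, hx⟩
  have hsat : ∀ x y, R.r x y → x ∈ B → y ∈ B := by
    intro x y hxy hx
    obtain ⟨z, hz, hxz⟩ := hBR x hx
    exact hRB y (hc.saturated x hx.2 y hxy) z hz (R.trans (R.symm hxy) hxz)
  have hB1 : μ B = 1 := by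
    refine (herg B hB hsat).resolve_left fun h0 => hP0 ?_
    refine measure_mono_null (t := B ∪ Sᶜ) (fun x hx => ?_) (measure_union_null h0 hc.conull)
    by_cases hxS : x ∈ S
    · exact Or.inl (hRB x hxS x hx (R.refl x))
    · exact Or.inr hxS
  have : ∀ᵐ x ∂μ, x ∈ B := by
    rw [← prob_compl_eq_zero_iff hB] at hB1
    exact hB1
  exact this.mono hBR

/-- Greedy exhaustion of `P` and `Q` by countably many partial injections from `P` to `Q`. -/
lemma exists_greedy {Y : Type*} [MeasurableSpace Y] [StandardBorelSpace Y]
    [MeasurableSpace.CountablySeparated X]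
    (g : ℕ → Y → X) (C : ℕ → Set Y) (hg : ∀ n, Measurable (g n)) (hC : ∀ n, MeasurableSet (C n))
    (hinj : ∀ n, InjOn (g n) (C n)) {P : Set Y} {Q : Set X} (hP : MeasurableSet P)
    (hQ : MeasurableSet Q) :
    ∃ E : ℕ → Set Y, (∀ n, MeasurableSet (E n)) ∧ (∀ n, E n ⊆ P ∩ C n) ∧
      Pairwise (fun m n => Disjoint (E m) (E n)) ∧
      Pairwise (fun m n => Disjoint (g m '' E m) (g n '' E n)) ∧ (∀ n, g n '' E n ⊆ Q) ∧
      ∀ n, ∀ y ∈ P ∩ C n, g n y ∈ Q → y ∈ ⋃ m, E m ∨ g n y ∈ ⋃ m, g m '' E m := by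
  -- The pair `st n` is what is left of `P` and `Q` before stage `n`; that stage uses every
  -- remaining point which `g n` sends into the remaining part of `Q`.
  let step : ℕ → Set Y × Set X → Set Y := fun n s => s.1 ∩ C n ∩ g n ⁻¹' s.2
  let st : ℕ → Set Y × Set X := fun n => Nat.rec (P, Q)
    (fun n s => (s.1 \ step n s, s.2 \ g n '' step n s)) n
  let E : ℕ → Set Y := fun n => step n (st n)
  have hst : ∀ n, st (n + 1) = ((st n).1 \ E n, (st n).2 \ g n '' E n) := fun n => rfl
  have hEC : ∀ n, E n ⊆ C n := fun n x hx => hx.1.2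
  have hE1 : ∀ n, E n ⊆ (st n).1 := fun n x hx => hx.1.1
  have hE2 : ∀ n, g n '' E n ⊆ (st n).2 := by
    rintro n _ ⟨x, hx, rfl⟩
    exact hx.2
  have hanti : ∀ m n, m ≤ n → (st n).1 ⊆ (st m).1 ∧ (st n).2 ⊆ (st m).2 := by
    intro m n hmn
    induction n, hmn using Nat.le_induction with
    | base => exact ⟨le_rfl, le_rfl⟩
    | succ n _ ih =>
      rw [hst]
      exact ⟨sdiff_subset.trans ih.1, sdiff_subset.trans ih.2⟩
  have hmeas : ∀ n, MeasurableSet (st n).1 ∧ MeasurableSet (st n).2 ∧ MeasurableSet (E n) := by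
    have hE : ∀ n, MeasurableSet (st n).1 → MeasurableSet (st n).2 → MeasurableSet (E n) :=
      fun n h1 h2 => (h1.inter (hC n)).inter (hg n h2)
    intro n
    induction n with
    | zero => exact ⟨hP, hQ, hE 0 hP hQ⟩
    | succ n ih =>
      obtain ⟨h1, h2, h3⟩ := ih
      have h4 : MeasurableSet (st (n + 1)).1 := h1.diff h3
      have h5 : MeasurableSet (st (n + 1)).2 := h2.diff
        (h3.image_of_measurable_injOn (hg n) ((hinj n).mono (hEC n)))
      exact ⟨h4, h5, hE (n + 1) h4 h5⟩
  have hlt : ∀ m n, m < n → Disjoint (E m) (E n) ∧ Disjoint (g m '' E m) (g n '' E n) := by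
    intro m n hmn
    have h := hanti (m + 1) n hmn
    rw [hst] at h
    constructor
    · exact disjoint_left.2 fun x hx hx' => (h.1 (hE1 n hx')).2 hx
    · exact disjoint_left.2 fun x hx hx' => (h.2 (hE2 n hx')).2 hx
  refine ⟨E, fun n => (hmeas n).2.2,
    fun n x hx => ⟨(hanti 0 n n.zero_le).1 (hE1 n hx), hEC n hx⟩, ?_, ?_,
    fun n => (hE2 n).trans (hanti 0 n n.zero_le).2, ?_⟩
  · intro m n hmn
    rcases hmn.lt_or_gt with h | h
    · exact (hlt _ _ h).1
    · exact (hlt _ _ h).1.symm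
  · intro m n hmn
    rcases hmn.lt_or_gt with h | h
    · exact (hlt _ _ h).2
    · exact (hlt _ _ h).2.symm
  · intro n y hy hyQ
    by_contra hcon
    rw [not_or] at hcon
    have h1 : ∀ k, y ∈ (st k).1 := by
      intro k
      induction k with
      | zero => exact hy.1
      | succ k ih => exact ⟨ih, fun h => hcon.1 (mem_iUnion.2 ⟨k, h⟩)⟩
    have h2 : ∀ k, g n y ∈ (st k).2 := by
      intro k
      induction k with
      | zero => exact hyQ
      | succ k ih => exact ⟨ih, fun h => hcon.2 (mem_iUnion.2 ⟨k, h⟩)⟩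
    -- Had both the point and its image survived forever, stage `n` would have taken them.
    exact hcon.1 (mem_iUnion.2 ⟨n, ⟨h1 n, hy.2⟩, h2 n⟩)

variable [StandardBorelSpace X]

/-- In an ergodic relation of type `II₁`, countably many sets can be packed disjointly, up to null
sets, into a set of sufficient measure. -/
lemma IsCover.exists_packing {R : Setoid X} {μ : Measure X} [IsProbabilityMeasure μ]
    {g : ℕ → X → X} {C : ℕ → Set X} {S : Set X} (hc : IsCover R μ g C S)
    (hII : IsTypeII1 R μ) (herg : IsErgodic R μ) {D : ℕ → Set X} (hD : ∀ i, MeasurableSet (D i))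
    {Q : Set X} (hQ : MeasurableSet Q) (hDQ : ∑' i, μ (D i) ≤ μ Q) :
    ∃ (p : ℕ → X → X) (D' : ℕ → Set X), (∀ i, IsPartial R (p i) (D' i)) ∧ (∀ i, D' i ⊆ D i) ∧
      (∀ i, μ (D i \ D' i) = 0) ∧ (∀ i, p i '' D' i ⊆ Q) ∧
      Pairwise fun i j => Disjoint (p i '' D' i) (p j '' D' j) := by
  -- The disjoint union of the `D i` serves as a single source in `ℕ × X`. An index `m` codes a
  -- pair: the copy, then the map of the cover.
  obtain ⟨E, hEm, hEP, hEd, hEi, hEQ, hEmax⟩ := exists_greedy (Y := ℕ × X)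
    (fun m y => g m.unpair.2 y.2) (fun m => {m.unpair.1} ×ˢ C m.unpair.2)
    (fun m => (hc.isPartial _).measurable.comp measurable_snd)
    (fun m => (MeasurableSet.singleton _).prod (hc.isPartial _).measurableSet)
    (by
      rintro m ⟨i, x⟩ ⟨hi, hx⟩ ⟨j, y⟩ ⟨hj, hy⟩ hxy
      obtain rfl : i = _ := hi
      obtain rfl : j = _ := hj
      exact Prod.ext rfl ((hc.isPartial _).injOn hx hy hxy))
    (P := {y | y.2 ∈ D y.1}) (Q := Q)
    (by
      have : {y : ℕ × X | y.2 ∈ D y.1} = ⋃ i, {i} ×ˢ D i := by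
        ext ⟨i, x⟩
        simp
      rw [this]
      exact MeasurableSet.iUnion fun i => (MeasurableSet.singleton i).prod (hD i)) hQ
  let G : ℕ → ℕ → Set X := fun i n => {x | (i, x) ∈ E (Nat.pair i n)}
  have hGm : ∀ i n, MeasurableSet (G i n) := fun i n => measurable_prodMk_left (hEm _)
  have hGD : ∀ i n, G i n ⊆ D i := fun i n x hx => (hEP _ hx).1
  have hGC : ∀ i n, G i n ⊆ C n := fun i n x hx => by
    simpa using (hEP _ hx).2.2
  have himg : ∀ i n, (fun y : ℕ × X => g (Nat.pair i n).unpair.2 y.2) '' E (Nat.pair i n) =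
      g n '' G i n := by
    intro i n
    ext z
    constructor
    · rintro ⟨⟨j, x⟩, hx, rfl⟩
      have hj : j = i := by simpa using (hEP _ hx).2.1
      subst hj
      exact ⟨x, hx, by simp⟩
    · rintro ⟨x, hx, rfl⟩
      exact ⟨(i, x), hx, by simp⟩
  have hGd : ∀ i m n, m ≠ n → Disjoint (G i m) (G i n) := by
    intro i m n hmn
    have h := hEd (show Nat.pair i m ≠ Nat.pair i n from fun h => hmn (Nat.pair_eq_pair.1 h).2)
    exact disjoint_left.2 fun x hx hx' => disjoint_left.1 h hx hx'
  have hGi : ∀ i m j n, (i, m) ≠ (j, n) → Disjoint (g m '' G i m) (g n '' G j n) := by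
    intro i m j n hne
    have h := hEi (show Nat.pair i m ≠ Nat.pair j n from fun h => hne
      (Prod.ext (Nat.pair_eq_pair.1 h).1 (Nat.pair_eq_pair.1 h).2))
    rw [← himg, ← himg]
    exact h
  have hidx := fun i => exists_measurable_index (G i) (hGm i)
  choose ν hν hνG using hidx
  have hνeq : ∀ i n, ∀ x ∈ G i n, ν i x = n := by
    intro i n x hx
    by_contra hne
    exact disjoint_left.1 (hGd i _ _ hne) (hνG i x n hx) hx
  let p : ℕ → X → X := fun i x => g (ν i x) x
  let D' : ℕ → Set X := fun i => ⋃ n, G i n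
  have hpG : ∀ i n, ∀ x ∈ G i n, p i x = g n x := fun i n x hx => by
    simp only [p, hνeq i n x hx]
  have hpimg : ∀ i, p i '' D' i = ⋃ n, g n '' G i n := by
    intro i
    rw [image_iUnion]
    exact iUnion_congr fun n => image_congr (hpG i n)
  have hD'm : ∀ i, MeasurableSet (D' i) := fun i => MeasurableSet.iUnion (hGm i)
  have hD'D : ∀ i, D' i ⊆ D i := fun i => iUnion_subset (hGD i)
  have hQ' : ∀ i, p i '' D' i ⊆ Q := by
    intro i
    rw [hpimg]
    exact iUnion_subset fun n => himg i n ▸ hEQ _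
  refine ⟨p, D', ?_, hD'D, ?_, hQ', ?_⟩
  · intro i
    refine ⟨measurable_apply_index (fun n => (hc.isPartial n).measurable) (hν i), hD'm i, ?_, ?_⟩
    · intro x hx y hy hxy
      obtain ⟨m, hm⟩ := mem_iUnion.1 hx
      obtain ⟨n, hn⟩ := mem_iUnion.1 hy
      rw [hpG i m x hm, hpG i n y hn] at hxy
      by_cases hmn : m = n
      · subst hmn
        exact (hc.isPartial m).injOn (hGC i m hm) (hGC i m hn) hxy
      · refine absurd (hGi i m i n (by simpa using hmn)) ?_
        exact not_disjoint_iff.2 ⟨_, mem_image_of_mem _ hm, hxy ▸ mem_image_of_mem _ hn⟩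
    · intro x hx
      obtain ⟨m, hm⟩ := mem_iUnion.1 hx
      rw [hpG i m x hm]
      exact (hc.isPartial m).rel x (hGC i m hm)
  · intro i
    -- If a non-null part of `D i` were unused, ergodicity would join almost every unused point of
    -- `Q` to it, against maximality. So `Q` is exhausted, and comparing measures gives `μ Q ≤ ∑ μ
    -- (D' j) < ∑ μ (D j) ≤ μ Q`.
    by_contra hpos
    let I : Set X := ⋃ j, p j '' D' j
    have hrest : μ (Q \ I) = 0 := by
      have h1 := hc.ae_exists_rel herg ((hD i).diff (hD'm i)) hpos
      have h2 : ∀ᵐ x ∂μ, x ∈ S := hc.conull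
      refine measure_mono_null ?_ (ae_iff.1 (h1.and h2))
      rintro x ⟨hxQ, hxI⟩ ⟨⟨y, hy, hxy⟩, hxS⟩
      obtain ⟨n, hn, rfl⟩ := hc.exists_eq y (hc.saturated x hxS y hxy) x (R.symm hxy)
      have h3 := hEmax (Nat.pair i n) (i, y) ⟨hy.1, by simpa using hn⟩ (by simpa using hxQ)
      rcases h3 with h3 | h3
      · obtain ⟨m, hm⟩ := mem_iUnion.1 h3
        have hi : i = m.unpair.1 := (hEP _ hm).2.1
        refine hy.2 (mem_iUnion.2 ⟨m.unpair.2, ?_⟩)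
        simp only [G, hi, Nat.pair_unpair, mem_ofPred_eq]
        rwa [← hi]
      · obtain ⟨m, hm⟩ := mem_iUnion.1 h3
        have hm' := himg m.unpair.1 m.unpair.2
        rw [Nat.pair_unpair] at hm'
        rw [hm'] at hm
        refine hxI (mem_iUnion.2 ⟨m.unpair.1, ?_⟩)
        rw [hpimg]
        exact mem_iUnion.2 ⟨m.unpair.2, by simpa using hm⟩
    have hfin : ∑' j, μ (D' j) ≠ ∞ :=
      ne_top_of_le_ne_top (measure_ne_top μ Q) ((ENNReal.tsum_le_tsum fun j =>
        measure_mono (hD'D j)).trans hDQ)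
    have hlt : ∑' j, μ (D' j) < ∑' j, μ (D j) := by
      refine ENNReal.tsum_lt_tsum (i := i) hfin (fun j => measure_mono (hD'D j)) ?_
      rw [← measure_sdiff_add_inter (μ := μ) (D i) (hD'm i), inter_eq_right.2 (hD'D i), add_comm]
      exact ENNReal.lt_add_right (measure_ne_top _ _) hpos
    have hI : μ I ≤ ∑' j, μ (D' j) := by
      refine (measure_iUnion_le _).trans (ENNReal.tsum_le_tsum fun j => ?_)
      rw [hpimg, measure_iUnion (fun m n hmn => hGd j m n hmn) (hGm j)]
      refine (measure_iUnion_le _).trans (ENNReal.tsum_le_tsum fun n => ?_)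
      exact ((hc.isPartial n).measure_image hII (hGm j n) (hGC j n)).le
    have hQI : μ Q ≤ μ I := by
      calc μ Q ≤ μ (Q \ I ∪ I) := measure_mono (by simp)
        _ ≤ μ (Q \ I) + μ I := measure_union_le _ _
        _ = μ I := by rw [hrest, zero_add]
    exact absurd (hDQ.trans (hQI.trans hI)) (not_le.2 hlt)
  · intro i j hij
    simp only [hpimg]
    refine disjoint_iUnion_left.2 fun m => disjoint_iUnion_right.2 fun n => ?_
    exact hGi i m j n (by simp [hij])

/-- A non-atomic standard probability space has measurable subsets of any given measure. -/
lemma exists_measurableSet_measure_eq (μ : Measure X) [IsProbabilityMeasure μ]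
    [NullSingletonClass μ] {c : ℝ} (h0 : 0 < c) (h1 : c < 1) :
    ∃ A : Set X, MeasurableSet A ∧ μ A = ENNReal.ofReal c := by
  -- Transported to the line, the measure has no atoms; its distribution function is continuous and
  -- takes the value `c`.
  let e := embeddingReal X
  have he : MeasurableEmbedding e := measurableEmbedding_embeddingReal X
  let ν := μ.map e
  have : IsProbabilityMeasure ν := Measure.isProbabilityMeasure_map he.measurable.aemeasurable
  have hν : ∀ a, ν {a} = 0 := by
    intro a
    rw [Measure.map_apply he.measurable (measurableSet_singleton a)]
    exact Subsingleton.measure_zero (fun x hx y hy => he.injective (hx.trans hy.symm)) μ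
  have hcont : Continuous (ProbabilityTheory.cdf ν) := by
    refine continuous_iff_continuousAt.2 fun a => ?_
    rw [(ProbabilityTheory.monotone_cdf ν).continuousAt_iff_leftLim_eq_rightLim,
      StieltjesFunction.rightLim_eq]
    have h := (ProbabilityTheory.cdf ν).measure_singleton a
    rw [ProbabilityTheory.measure_cdf, hν, eq_comm, ENNReal.ofReal_eq_zero, sub_nonpos] at h
    exact le_antisymm ((ProbabilityTheory.monotone_cdf ν).leftLim_le le_rfl) h
  obtain ⟨a, ha⟩ := mem_range_of_exists_le_of_exists_ge hcont
    (((ProbabilityTheory.tendsto_cdf_atBot ν).eventually (gt_mem_nhds h0)).exists.imp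
      fun _ h => le_of_lt h)
    (((ProbabilityTheory.tendsto_cdf_atTop ν).eventually (lt_mem_nhds h1)).exists.imp
      fun _ h => le_of_lt h)
  refine ⟨e ⁻¹' Iic a, he.measurable measurableSet_Iic, ?_⟩
  rw [← Measure.map_apply he.measurable measurableSet_Iic, ← ha]
  exact (ProbabilityTheory.ofReal_cdf ν a).symm

end

/-! ### Actions of `ℤ/N` inside `R`, and chains through the fibres of a map. -/

section

variable {X : Type*} [MeasurableSpace X] [StandardBorelSpace X]

lemma IsPartial.exists_inverse {R : Setoid X} {f : X → X} {D : Set X} (h : IsPartial R f D) :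
    ∃ f' : X → X, Measurable f' ∧ ∀ x ∈ D, f' (f x) = x := by
  obtain ⟨φ, hdom, hgraph, -⟩ := h.exists_partialAut
  obtain ⟨k, k', -, hk', hkk, -, hg⟩ := φ.exists_isPartial
  refine ⟨k', hk'.measurable, fun x hx => ?_⟩
  have h1 : (x, f x) ∈ φ.graph := hgraph ▸ ⟨hx, rfl⟩
  rw [hg] at h1
  rw [show f x = k x from h1.2]
  exact (hkk x h1.1).2

/-- An ergodic relation of type `II₁` contains an almost free action of `ℤ/N`, together with a set
of measure `1/N` meeting almost every orbit. -/
lemma IsCover.exists_action {R : Setoid X} {μ : Measure X} [IsProbabilityMeasure μ]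
    [NullSingletonClass μ] {g : ℕ → X → X} {C : ℕ → Set X} {S : Set X} (hc : IsCover R μ g C S)
    (hII : IsTypeII1 R μ) (herg : IsErgodic R μ) (N : ℕ) (hN : 2 ≤ N) :
    ∃ (A : Set X) (T : ZMod N → X ≃ᵐ X), MeasurableSet A ∧ μ A = (N : ℝ≥0∞)⁻¹ ∧
      (∀ s, T s ∈ fullGroup R) ∧ (∀ s t x, T s (T t x) = T (s + t) x) ∧
      (∀ s t, s ≠ t → ∀ᵐ x ∂μ, T s x ≠ T t x) ∧ ∀ᵐ x ∂μ, ∃ s, T s x ∈ A := by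
  classical
  have : NeZero N := ⟨by omega⟩
  have : Encodable (ZMod N) := Encodable.ofCountable _
  let _ : MeasurableSpace (ZMod N) := ⊤
  have hN0 : (N : ℝ≥0∞) ≠ 0 := by simpa using NeZero.ne N
  obtain ⟨A₀, hA₀, hμA₀⟩ : ∃ A₀ : Set X, MeasurableSet A₀ ∧ μ A₀ = (N : ℝ≥0∞)⁻¹ := by
    have hN' : (1 : ℝ) < N := by exact_mod_cast hN
    obtain ⟨A₀, h, h'⟩ := exists_measurableSet_measure_eq μ (c := (N : ℝ)⁻¹) (by positivity)
      (inv_lt_one_of_one_lt₀ hN')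
    refine ⟨A₀, h, h'.trans ?_⟩
    rw [ENNReal.ofReal_inv_of_pos (by positivity), ENNReal.ofReal_natCast]
  -- `N` copies of a set of measure `1/N` are packed into `X`, and so fill it up to a null set.
  obtain ⟨p, D', hp, hD'A, hD'0, -, hpd⟩ := hc.exists_packing hII herg
    (D := fun i => if i < N then A₀ else ∅) (Q := univ)
    (fun i => by split_ifs; exacts [hA₀, .empty]) .univ (by
      rw [tsum_eq_sum (s := Finset.range N) (by
        intro i hi
        have : ¬ i < N := by simpa using hi
        simp [this])]
      rw [Finset.sum_congr rfl (g := fun _ => (N : ℝ≥0∞)⁻¹)]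
      · simp [ENNReal.mul_inv_cancel hN0]
      · intro i hi
        have : i < N := by simpa using hi
        simp [this, hμA₀])
  let c : ZMod N → X → X := fun s => p s.val
  let A' : Set X := ⋂ s : ZMod N, D' s.val
  have hA'D : ∀ s : ZMod N, A' ⊆ D' s.val := fun s => iInter_subset _ s
  have hA'm : MeasurableSet A' := MeasurableSet.iInter fun s => (hp _).measurableSet
  have hcp : ∀ s, IsPartial R (c s) A' := fun s => (hp _).mono hA'm (hA'D s)
  have hA'A : A' ⊆ A₀ := by
    refine (hA'D 0).trans ((hD'A _).trans ?_)
    split_ifs <;> simp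
  have hμA' : μ A' = (N : ℝ≥0∞)⁻¹ := by
    rw [← hμA₀]
    refine le_antisymm (measure_mono hA'A) ?_
    have h0 : μ (A₀ \ A') = 0 := by
      simp only [A', sdiff_iInter]
      refine measure_iUnion_null fun s => ?_
      have := hD'0 s.val
      simpa [ZMod.val_lt] using this
    calc μ A₀ ≤ μ (A₀ \ A' ∪ A') := measure_mono (by simp)
      _ ≤ μ (A₀ \ A') + μ A' := measure_union_le _ _
      _ = μ A' := by rw [h0, zero_add]
  let B : ZMod N → Set X := fun s => c s '' A'
  have hBm : ∀ s, MeasurableSet (B s) := fun s => (hcp s).measurableSet_image hA'm le_rfl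
  have hBd : ∀ s t, s ≠ t → Disjoint (B s) (B t) := fun s t hst =>
    (hpd fun h => hst (ZMod.val_injective N h)).mono (image_mono (hA'D s)) (image_mono (hA'D t))
  have hBμ : ∀ s, μ (B s) = (N : ℝ≥0∞)⁻¹ := fun s =>
    ((hcp s).measure_image hII hA'm le_rfl).trans hμA'
  let X' : Set X := ⋃ s, B s
  have hX'm : MeasurableSet X' := MeasurableSet.iUnion hBm
  have hX' : ∀ᵐ x ∂μ, x ∈ X' := by
    have : μ X' = 1 := by
      rw [measure_iUnion (fun s t hst => hBd s t hst) hBm, tsum_fintype]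
      simp [hBμ, ZMod.card, ENNReal.mul_inv_cancel hN0]
    rw [← prob_compl_eq_zero_iff hX'm] at this
    exact this
  choose d hdm hd using fun s => (hcp s).exists_inverse
  obtain ⟨j, hjm, hj⟩ := exists_measurable_index B hBm
  have hjc : ∀ s, ∀ a ∈ A', j (c s a) = s := by
    intro s a ha
    by_contra hne
    have h1 : c s a ∈ B s := mem_image_of_mem _ ha
    exact disjoint_left.1 (hBd _ _ hne) (hj _ s h1) h1
  -- The action shifts the index of the copy. Being the identity off the copies, it satisfies the
  -- group law at every point, and is free only almost everywhere.
  let τ : ZMod N → X → X := fun s x => if x ∈ X' then c (j x + s) (d (j x) x) else x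
  have hτc : ∀ s t, ∀ a ∈ A', τ s (c t a) = c (t + s) a := by
    intro s t a ha
    have h1 : c t a ∈ X' := mem_iUnion.2 ⟨t, mem_image_of_mem _ ha⟩
    simp only [τ, if_pos h1, hjc t a ha, hd t a ha]
  have hτn : ∀ s, ∀ x ∉ X', τ s x = x := fun s x hx => if_neg hx
  have hτm : ∀ s, Measurable (τ s) := by
    intro s
    refine Measurable.ite hX'm ?_ measurable_id
    exact measurable_apply_index (g := fun i x => c (i + s) (d i x))
      (fun i => (hcp _).measurable.comp (hdm i)) hjm
  have hcases : ∀ x, x ∉ X' ∨ ∃ t, ∃ a ∈ A', c t a = x := by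
    intro x
    by_cases hx : x ∈ X'
    · obtain ⟨t, a, ha, h⟩ := mem_iUnion.1 hx
      exact Or.inr ⟨t, a, ha, h⟩
    · exact Or.inl hx
  have hadd : ∀ s t x, τ s (τ t x) = τ (s + t) x := by
    intro s t x
    rcases hcases x with hx | ⟨u, a, ha, rfl⟩
    · rw [hτn t x hx, hτn s x hx, hτn _ x hx]
    · rw [hτc t u a ha, hτc s _ a ha, hτc _ u a ha, add_assoc, add_comm t s]
  have hzero : ∀ x, τ 0 x = x := by
    intro x
    rcases hcases x with hx | ⟨u, a, ha, rfl⟩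
    · exact hτn 0 x hx
    · rw [hτc 0 u a ha, add_zero]
  refine ⟨B 0, fun s => ⟨⟨τ s, τ (-s), fun x => by rw [hadd, neg_add_cancel, hzero],
    fun x => by rw [hadd, add_neg_cancel, hzero]⟩, hτm s, hτm (-s)⟩, hBm 0, hBμ 0, ?_, hadd, ?_, ?_⟩
  · intro s x
    change R.r x (τ s x)
    rcases hcases x with hx | ⟨u, a, ha, rfl⟩
    · rw [hτn s x hx]
    · rw [hτc s u a ha]
      exact R.trans (R.symm ((hcp u).rel a ha)) ((hcp _).rel a ha)
  · intro s t hst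
    filter_upwards [hX'] with x hx
    change τ s x ≠ τ t x
    obtain ⟨u, a, ha, rfl⟩ := mem_iUnion.1 hx
    rw [hτc s u a ha, hτc t u a ha]
    intro h
    have h1 := congrArg j h
    rw [hjc _ a ha, hjc _ a ha] at h1
    exact hst (add_left_cancel h1)
  · filter_upwards [hX'] with x hx
    obtain ⟨u, a, ha, rfl⟩ := mem_iUnion.1 hx
    refine ⟨-u, ?_⟩
    change τ (-u) (c u a) ∈ B 0
    rw [hτc _ u a ha, add_neg_cancel]
    exact mem_image_of_mem _ ha

/-- A measurable map `q` on `P` moving points inside their classes can be generated by one partial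
automorphism defined on a subset of `P` and another one defined on its complement in `P`: each fibre
of `q` is run through by a chain, whose first point is joined to the common value of `q`. -/
lemma IsCover.exists_chain {R : Setoid X} {μ : Measure X} {g : ℕ → X → X} {C : ℕ → Set X}
    {S : Set X} (hc : IsCover R μ g C S) {P : Set X} (hP : MeasurableSet P) (hPS : P ⊆ S)
    {q : X → X} (hq : Measurable q) (hqR : ∀ x ∈ P, R.r x (q x)) :
    ∃ (σ : X → X) (P' : Set X), P' ⊆ P ∧ IsPartial R σ P' ∧ IsPartial R q (P \ P') ∧
      ∀ x ∈ P, Relation.EqvGen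
        (fun a b => (a ∈ P' ∧ b = σ a) ∨ (a ∈ P \ P' ∧ b = q a)) x (q x) := by
  have hC : ∀ n, MeasurableSet (C n) := fun n => (hc.isPartial n).measurableSet
  have hg : ∀ n, Measurable (g n) := fun n => (hc.isPartial n).measurable
  -- The index of a map sending `x` to `q x`. Since these maps are injective, `ν` is injective on
  -- each fibre of `q` and orders it like a subset of `ℕ`.
  obtain ⟨ν, hνm, hν⟩ := exists_measurable_index (fun n => C n ∩ {x | g n x = q x})
    (fun n => (hC n).inter (measurableSet_eq_fun (hg n) hq))
  have hνP : ∀ x ∈ P, x ∈ C (ν x) ∧ g (ν x) x = q x := by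
    intro x hx
    obtain ⟨n, hn, hn'⟩ := hc.exists_eq x (hPS hx) _ (hqR x hx)
    exact hν x n ⟨hn, hn'⟩
  have hνinj : ∀ x ∈ P, ∀ y ∈ P, q x = q y → ν x = ν y → x = y := by
    intro x hx y hy hxy hn
    refine (hc.isPartial (ν x)).injOn (hνP x hx).1 (hn ▸ (hνP y hy).1) ?_
    rw [(hνP x hx).2, hxy, hn, (hνP y hy).2]
  -- `L k` consists of the points whose `k`-th neighbour lies in the same fibre, with smaller index
  let L : ℕ → Set X := fun k => P ∩ g k ⁻¹' P ∩ {x | q (g k x) = q x} ∩ {x | ν (g k x) < ν x}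
  have hLm : ∀ k, MeasurableSet (L k) := fun k =>
    (((hP.inter (hg k hP)).inter (measurableSet_eq_fun (hq.comp (hg k)) hq)).inter
      (measurableSet_lt (hνm.comp (hg k)) hνm))
  -- Here the `k`-th neighbour is the immediate predecessor in the fibre. So `σ` below is the
  -- predecessor map, and only the least point of each fibre is left to `q`, which makes `q`
  -- injective there.
  let V : ℕ → Set X := fun k => L k ∩ ⋂ l, {x | x ∈ L l → ν (g l x) ≤ ν (g k x)}
  have hVm : ∀ k, MeasurableSet (V k) := by
    refine fun k => (hLm k).inter (MeasurableSet.iInter fun l => ?_)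
    have h := (hLm l).compl.union (measurableSet_le (hνm.comp (hg l)) (hνm.comp (hg k)))
    convert! h using 1
    ext x
    simp [imp_iff_not_or]
  obtain ⟨κ, hκm, hκ⟩ := exists_measurable_index V hVm
  let σ : X → X := fun x => g (κ x) x
  let P' : Set X := ⋃ k, V k
  have hP'm : MeasurableSet P' := MeasurableSet.iUnion hVm
  have hP'P : P' ⊆ P := iUnion_subset fun k x hx => hx.1.1.1.1
  have hlist : ∀ x ∈ P, ∀ y ∈ P, q y = q x → ∃ k, g k x = y := by
    intro x hx y hy hxy
    obtain ⟨k, -, hk⟩ := hc.exists_eq x (hPS hx) y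
      (R.trans (hqR x hx) (hxy ▸ R.symm (hqR y hy)))
    exact ⟨k, hk⟩
  have hσ : ∀ x ∈ P', σ x ∈ P ∧ q (σ x) = q x ∧ ν (σ x) < ν x ∧
      ∀ y ∈ P, q y = q x → ν y < ν x → ν y ≤ ν (σ x) := by
    intro x hx
    obtain ⟨k, hk⟩ := mem_iUnion.1 hx
    have h := hκ x k hk
    refine ⟨h.1.1.1.2, h.1.1.2, h.1.2, fun y hy hxy hlt => ?_⟩
    obtain ⟨l, rfl⟩ := hlist x (hP'P hx) y hy hxy
    exact mem_iInter.1 h.2 l ⟨⟨⟨hP'P hx, hy⟩, hxy⟩, hlt⟩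
  have hmin : ∀ x ∈ P, x ∉ P' → ∀ y ∈ P, q y = q x → ν x ≤ ν y := by
    intro x hx hx' y hy hxy
    by_contra! hlt
    refine hx' ?_
    let I : Set ℕ := {n | ∃ k, x ∈ L k ∧ ν (g k x) = n}
    obtain ⟨l, rfl⟩ := hlist x hx y hy hxy
    have hI : I.Nonempty := ⟨_, l, ⟨⟨⟨hx, hy⟩, hxy⟩, hlt⟩, rfl⟩
    have hIb : BddAbove I := ⟨ν x, by rintro _ ⟨k, hk, rfl⟩; exact hk.2.le⟩
    obtain ⟨k, hk, hk'⟩ := Nat.sSup_mem hI hIb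
    refine mem_iUnion.2 ⟨k, hk, mem_iInter.2 fun m hm => ?_⟩
    rw [hk']
    exact le_csSup hIb ⟨m, hm, rfl⟩
  refine ⟨σ, P', hP'P, ⟨measurable_apply_index hg hκm, hP'm, ?_, ?_⟩, ⟨hq, hP.diff hP'm, ?_, ?_⟩, ?_⟩
  · intro x hx y hy hxy
    obtain ⟨-, hx2, hx3, hx4⟩ := hσ x hx
    obtain ⟨-, hy2, hy3, hy4⟩ := hσ y hy
    have hqq : q x = q y := by rw [← hx2, hxy, hy2]
    refine hνinj x (hP'P hx) y (hP'P hy) hqq ?_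
    rcases lt_trichotomy (ν x) (ν y) with h | h | h
    · have := hy4 x (hP'P hx) hqq h
      rw [← hxy] at this
      omega
    · exact h
    · have := hx4 y (hP'P hy) hqq.symm h
      rw [hxy] at this
      omega
  · intro x hx
    obtain ⟨hx1, hx2, -, -⟩ := hσ x hx
    exact R.trans (hqR x (hP'P hx)) (hx2 ▸ R.symm (hqR _ hx1))
  · intro x hx y hy hxy
    exact hνinj x hx.1 y hy.1 hxy (le_antisymm (hmin x hx.1 hx.2 y hy.1 hxy.symm)
      (hmin y hy.1 hy.2 x hx.1 hxy))
  · exact fun x hx => hqR x hx.1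
  · intro x hx
    induction hn : ν x using Nat.strong_induction_on generalizing x with
    | _ n ih =>
      by_cases hx' : x ∈ P'
      · obtain ⟨hx1, hx2, hx3, -⟩ := hσ x hx'
        have := ih (ν (σ x)) (hn ▸ hx3) (σ x) hx1 rfl
        rw [hx2] at this
        exact .trans _ _ _ (.rel _ _ (Or.inl ⟨hx', rfl⟩)) this
      · exact .rel _ _ (Or.inr ⟨⟨hx, hx'⟩, rfl⟩)

end

/-! ### Contraction of a graphing onto a set. -/

section

variable {X : Type*} [MeasurableSpace X] [StandardBorelSpace X]

/-- Contraction of a graphing along a forest directed towards a measurable set `A`. The sets `U i`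
are made of the edges of the forest, `B` is the set of points connected to `A`, and `r` is the
retraction. -/
lemma IsDoubled.exists_contraction {R : Setoid X} {μ : Measure X} (hII : IsTypeII1 R μ)
    {F : ℕ × Bool → X → X} {C : ℕ × Bool → Set X} (hF : IsDoubled R F C) {A : Set X}
    (hA : MeasurableSet A) :
    ∃ (r : X → X) (B : Set X) (U : ℕ → Set X), Measurable r ∧ MeasurableSet B ∧ A ⊆ B ∧
      (∀ x, ∀ a ∈ A, Relation.EqvGen (doubledEdge F C) x a → x ∈ B) ∧
      (∀ x ∈ B, r x ∈ A) ∧ (∀ x, R.r x (r x)) ∧ (∀ a ∈ A, r a = a) ∧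
      (∀ i, MeasurableSet (U i)) ∧ (∀ i, ∀ x ∈ U i, r x = r (F (i, true) x)) ∧
      ∑' i, μ (C (i, true) \ U i) + μ (B \ A) = ∑' i, μ (C (i, true)) := by
  classical
  have hCm : ∀ j, MeasurableSet (C j) := fun j => (hF.isPartial j).measurableSet
  have hFm : ∀ j, Measurable (F j) := fun j => (hF.isPartial j).measurable
  -- The ball of radius `k` around `A` in the graph; `lev` will be the distance to `A`.
  let b : ℕ → Set X := fun k => Nat.rec A (fun _ s => s ∪ ⋃ j, C j ∩ F j ⁻¹' s) k
  have hb0 : b 0 = A := rfl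
  have hbs : ∀ k, b (k + 1) = b k ∪ ⋃ j, C j ∩ F j ⁻¹' b k := fun k => rfl
  have hbm : ∀ k, MeasurableSet (b k) := by
    intro k
    induction k with
    | zero => exact hA
    | succ k ih => exact ih.union (MeasurableSet.iUnion fun j => (hCm j).inter (hFm j ih))
  let B : Set X := ⋃ k, b k
  have hBm : MeasurableSet B := MeasurableSet.iUnion hbm
  have hAB : A ⊆ B := fun x hx => mem_iUnion.2 ⟨0, hx⟩
  have hstepB : ∀ j, ∀ x ∈ C j, F j x ∈ B → x ∈ B := by
    intro j x hx hxB
    obtain ⟨k, hk⟩ := mem_iUnion.1 hxB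
    exact mem_iUnion.2 ⟨k + 1, Or.inr (mem_iUnion.2 ⟨j, hx, hk⟩)⟩
  obtain ⟨lev, hlevm, hlev⟩ := exists_measurable_index (fun k => b k ∩ ⋂ l, {x | x ∈ b l → k ≤ l})
    (by
      refine fun k => (hbm k).inter (MeasurableSet.iInter fun l => ?_)
      by_cases hkl : k ≤ l
      · simp [hkl]
      · convert! (hbm l).compl using 1
        ext x
        simp [hkl])
  have hlevB : ∀ x ∈ B, x ∈ b (lev x) ∧ ∀ k, x ∈ b k → lev x ≤ k := by
    intro x hx
    have hex : ∃ k, x ∈ b k := mem_iUnion.1 hx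
    obtain ⟨k, hk, hkmin⟩ : ∃ k, x ∈ b k ∧ ∀ l, x ∈ b l → k ≤ l :=
      ⟨sInf {k | x ∈ b k}, Nat.sInf_mem hex, fun l hl => Nat.sInf_le hl⟩
    have h := hlev x k ⟨hk, mem_iInter.2 hkmin⟩
    exact ⟨h.1, fun k hk => mem_iInter.1 h.2 k hk⟩
  -- A choice, at each point of `B \ A`, of an edge that decreases the distance; `par` follows it,
  -- and `r` iterates `par` until `A` is reached.
  obtain ⟨π, hπm, hπ⟩ := exists_measurable_index
    (fun j => C j ∩ F j ⁻¹' B ∩ {x | lev (F j x) < lev x})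
    (fun j => ((hCm j).inter (hFm j hBm)).inter
      (measurableSet_lt (hlevm.comp (hFm j)) hlevm))
  let par : X → X := fun x => if x ∈ B \ A then F (π x) x else x
  have hparm : Measurable par :=
    Measurable.ite (hBm.diff hA) (measurable_apply_index hFm hπm) measurable_id
  have hπB : ∀ x ∈ B \ A, x ∈ C (π x) ∧ F (π x) x ∈ B ∧ lev (F (π x) x) < lev x := by
    rintro x ⟨hx, hxA⟩
    obtain ⟨h1, h2⟩ := hlevB x hx
    obtain ⟨k, hk⟩ : ∃ k, lev x = k + 1 := by
      refine Nat.exists_eq_succ_of_ne_zero fun h => hxA ?_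
      rwa [h] at h1
    rw [hk, hbs] at h1
    have h3 : x ∉ b k := fun h => by
      have := h2 k h
      omega
    obtain ⟨j, hj, hjb⟩ := mem_iUnion.1 (h1.resolve_left h3)
    have hjB : F j x ∈ B := mem_iUnion.2 ⟨k, hjb⟩
    have h4 := hπ x j ⟨⟨hj, hjB⟩, by
      have := (hlevB _ hjB).2 k hjb
      change lev (F j x) < lev x
      omega⟩
    exact ⟨h4.1.1, h4.1.2, h4.2⟩
  have hpar : ∀ x ∈ B \ A, par x = F (π x) x := fun x hx => if_pos hx
  have hparA : ∀ x ∈ A, par x = x := fun x hx => if_neg fun h => h.2 hx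
  have hparR : ∀ x, R.r x (par x) := by
    intro x
    by_cases hx : x ∈ B \ A
    · rw [hpar x hx]
      exact (hF.isPartial _).rel x (hπB x hx).1
    · simp only [par, if_neg hx]
      exact R.refl x
  have hiterA : ∀ n, ∀ x ∈ B, lev x ≤ n → par^[n] x ∈ A := by
    intro n
    induction n with
    | zero =>
      intro x hx h0
      have := (hlevB x hx).1
      rwa [Nat.le_zero.1 h0] at this
    | succ n ih =>
      intro x hx hn
      rw [Function.iterate_succ_apply]
      by_cases hxA : x ∈ A
      · rw [hparA x hxA]
        exact ih x hx (((hlevB x hx).2 0 hxA).trans n.zero_le)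
      · obtain ⟨-, h2, h3⟩ := hπB x ⟨hx, hxA⟩
        rw [hpar x ⟨hx, hxA⟩]
        exact ih _ h2 (by omega)
  have hiter : ∀ x ∈ B, ∀ n, lev x ≤ n → par^[n] x = par^[lev x] x := by
    intro x hx n hn
    obtain ⟨m, rfl⟩ := Nat.exists_eq_add_of_le' hn
    rw [Function.iterate_add_apply]
    exact Function.iterate_fixed (hparA _ (hiterA _ x hx le_rfl)) m
  let r : X → X := fun x => par^[lev x] x
  have hrpar : ∀ x ∈ B, r (par x) = r x := by
    intro x hx
    by_cases hxA : x ∈ A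
    · rw [hparA x hxA]
    · obtain ⟨-, h2, h3⟩ := hπB x ⟨hx, hxA⟩
      rw [← hpar x ⟨hx, hxA⟩] at h2 h3
      calc par^[lev (par x)] (par x) = par^[lev x] (par x) := (hiter _ h2 _ h3.le).symm
        _ = par^[lev x + 1] x := (Function.iterate_succ_apply _ _ _).symm
        _ = par^[lev x] x := hiter x hx _ (Nat.le_succ _)
  let W : ℕ × Bool → Set X := fun j => (B \ A) ∩ π ⁻¹' {j}
  have hWm : ∀ j, MeasurableSet (W j) := fun j => (hBm.diff hA).inter (hπm (measurableSet_singleton j))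
  have hWC : ∀ j, W j ⊆ C j := by
    rintro j x ⟨hx, rfl⟩
    exact (hπB x hx).1
  have hWpar : ∀ j, ∀ x ∈ W j, par x = F j x := by
    rintro j x ⟨hx, rfl⟩
    exact hpar x hx
  have hWlev : ∀ j, ∀ x ∈ W j, lev (F j x) < lev x := by
    rintro j x ⟨hx, rfl⟩
    exact (hπB x hx).2.2
  have hWB : ∀ j, W j ⊆ B := fun j x hx => hx.1.1
  -- An edge may be used forwards or backwards, and is recorded at its source in both cases. No edge
  -- is used both ways, as the level would drop in both directions.
  let U : ℕ → Set X := fun i => W (i, true) ∪ F (i, false) '' W (i, false)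
  have himgm : ∀ i, MeasurableSet (F (i, false) '' W (i, false)) := fun i =>
    (hF.isPartial (i, false)).measurableSet_image (hWm _) (hWC _)
  have hUm : ∀ i, MeasurableSet (U i) := fun i => (hWm _).union (himgm i)
  have hUC : ∀ i, U i ⊆ C (i, true) := by
    rintro i x (hx | ⟨y, hy, rfl⟩)
    · exact hWC _ hx
    · exact hF.mapsTo i false y (hWC _ hy)
  have hUμ : ∀ i, μ (U i) = μ (W (i, false)) + μ (W (i, true)) := by
    intro i
    rw [measure_union ?_ (himgm i), (hF.isPartial (i, false)).measure_image hII (hWm _) (hWC _),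
      add_comm]
    refine disjoint_left.2 ?_
    rintro _ hx ⟨y, hy, rfl⟩
    have h1 := hWlev _ _ hx
    have h2 : F (i, true) (F (i, false) y) = y := hF.inv i false y (hWC _ hy)
    have h3 := hWlev _ _ hy
    rw [h2] at h1
    exact absurd h1 (not_lt.2 h3.le)
  refine ⟨r, B, U, measurable_apply_index (fun n => hparm.iterate n) hlevm, hBm, hAB, ?_,
    fun x hx => hiterA _ x hx le_rfl, ?_, ?_, hUm, ?_, ?_⟩
  · intro x a ha hxa
    rw [← Relation.EqvGen.reflTransGen_symmGen] at hxa
    induction hxa using Relation.ReflTransGen.head_induction_on with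
    | refl => exact hAB ha
    | head h _ ih =>
      rcases h with ⟨i, hi, rfl⟩ | ⟨i, hi, rfl⟩
      · exact hstepB (i, true) _ hi ih
      · refine hstepB (i, false) _ (hF.mapsTo i true _ hi) ?_
        have := hF.inv i true _ hi
        simp only [Bool.not_true] at this
        rwa [this]
  · intro x
    change R.r x (par^[lev x] x)
    generalize lev x = n
    induction n with
    | zero => exact R.refl x
    | succ n ih =>
      rw [Function.iterate_succ_apply']
      exact R.trans ih (hparR _)
  · intro a ha
    exact Function.iterate_fixed (hparA a ha) _
  · rintro i x (hx | ⟨y, hy, rfl⟩)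
    · rw [← hWpar _ x hx, hrpar x (hWB _ hx)]
    · have h2 : F (i, true) (F (i, false) y) = y := hF.inv i false y (hWC _ hy)
      rw [h2, ← hWpar _ y hy, hrpar y (hWB _ hy)]
  -- Every point of `B \ A` owns exactly one edge of the forest.
  · have hBA : μ (B \ A) = ∑' i, μ (U i) := by
      have h1 : B \ A = ⋃ j, W j := by
        ext x
        simp [W]
      rw [h1, measure_iUnion ?_ hWm, ENNReal.tsum_prod']
      · refine tsum_congr fun i => ?_
        rw [hUμ, tsum_bool]
      · intro j k hjk
        refine disjoint_left.2 fun x hx hx' => hjk ?_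
        rw [← show π x = j from hx.2, ← show π x = k from hx'.2]
    rw [hBA, ← ENNReal.tsum_add]
    refine tsum_congr fun i => ?_
    rw [← measure_sdiff_add_inter (μ := μ) (C (i, true)) (hUm i), inter_eq_right.2 (hUC i)]

end

/-! ### Finite graphings and the boundary estimate. -/

section

/-- The union of the graphs of a family of partially defined maps. -/
def graphUnion {ι Z : Type*} (f : ι → Z → Z) (D : ι → Set Z) : Set (Z × Z) :=
  {p | ∃ i, p.1 ∈ D i ∧ p.2 = f i p.1}

lemma graphUnion_equiv {ι κ Z : Type*} (e : κ ≃ ι) (f : ι → Z → Z) (D : ι → Set Z) :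
    graphUnion (fun k => f (e k)) (fun k => D (e k)) = graphUnion f D := by
  ext p
  exact e.exists_congr_left.trans (by simp [graphUnion])

variable {X : Type*} [MeasurableSpace X] [StandardBorelSpace X]

/-- Finitely many partial automorphisms which generate `R` make up a finite graphing. -/
lemma isFiniteGraphing_graphUnion {R : Setoid X} {μ : Measure X} {ι : Type*} [Finite ι]
    {f : ι → X → X} {D : ι → Set X} (h : ∀ i, IsPartial R (f i) (D i))
    (hgen : ∀ᵐ x ∂μ, ∀ y, R.r x y →
      Relation.EqvGen (fun a b => (a, b) ∈ graphUnion f D) x y) :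
    IsFiniteGraphing R μ (graphUnion f D) := by
  refine ⟨⟨?_, ?_, hgen⟩, ?_⟩
  · have : graphUnion f D = ⋃ i, {p : X × X | p.1 ∈ D i ∧ p.2 = f i p.1} := by
      ext p
      simp [graphUnion]
    rw [this]
    exact MeasurableSet.iUnion fun i => (h i).measurableSet_graph
  · rintro ⟨x, y⟩ ⟨i, hi, hy⟩
    obtain rfl : y = f i x := hy
    exact (h i).rel x hi
  · obtain ⟨n, ⟨e⟩⟩ := Finite.exists_equiv_fin ι
    let f' : Fin n → X → X := fun k => f (e.symm k)
    let D' : Fin n → Set X := fun k => D (e.symm k)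
    -- Discarding the points where an earlier map takes the same value makes the graphs disjoint and
    -- keeps their union.
    let E : Fin n → Set X := fun k => D' k \ ⋃ l, ⋃ _ : l < k, D' l ∩ {x | f' l x = f' k x}
    have hE : ∀ k, IsPartial R (f' k) (E k) := by
      refine fun k => (h _).mono ((h _).measurableSet.diff (MeasurableSet.iUnion fun l =>
        MeasurableSet.iUnion fun _ => (h _).measurableSet.inter
          (measurableSet_eq_fun (h _).measurable (h _).measurable))) sdiff_subset
    choose φ _ hφ _ using fun k => (hE k).exists_partialAut
    have hlt : ∀ k l, k < l → Disjoint (φ k).graph (φ l).graph := by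
      intro k l hkl
      rw [hφ, hφ]
      refine disjoint_left.2 ?_
      rintro ⟨x, y⟩ ⟨hx, hy⟩ ⟨hx', hy'⟩
      exact hx'.2 (mem_iUnion.2 ⟨k, mem_iUnion.2 ⟨hkl, hx.1, hy.symm.trans hy'⟩⟩)
    refine ⟨n, φ, ?_, ?_⟩
    · intro k l hkl
      rcases hkl.lt_or_gt with h | h
      · exact hlt k l h
      · exact (hlt l k h).symm
    · rw [← graphUnion_equiv e.symm]
      ext ⟨x, y⟩
      simp only [mem_iUnion, hφ]
      constructor
      · rintro ⟨k, hk⟩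
        induction hn : k.val using Nat.strong_induction_on generalizing k with
        | _ m ih =>
          by_cases hx : x ∈ E k
          · exact ⟨k, hx, hk.2⟩
          · have : x ∈ ⋃ l, ⋃ _ : l < k, D' l ∩ {x | f' l x = f' k x} := by
              by_contra hcon
              exact hx ⟨hk.1, hcon⟩
            obtain ⟨l, hl⟩ := mem_iUnion.1 this
            obtain ⟨hlk, hl1, hl2⟩ := mem_iUnion.1 hl
            exact ih l (hn ▸ hlk) l ⟨hl1, hk.2.trans hl2.symm⟩ rfl
      · rintro ⟨k, hk, hy⟩
        exact ⟨k, hk.1, hy⟩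

/-- The boundary of the orbits of a finite group of automorphisms. -/
lemma edgeMeasure_edgeBoundary_le {R : Setoid X} {μ : Measure X} (hII : IsTypeII1 R μ)
    {G : Type*} [AddGroup G] [Fintype G] [DecidableEq (X ≃ᵐ X)] (T : G → X ≃ᵐ X)
    (hTR : ∀ s, T s ∈ fullGroup R) (hTadd : ∀ s t x, T s (T t x) = T (s + t) x)
    {κ : Type*} [Fintype κ] {f : κ → X → X} {D : κ → Set X}
    (h : ∀ k, IsPartial R (f k) (D k)) :
    edgeMeasure μ (edgeBoundary R
      (graphUnion (Sum.elim (fun s => ⇑(T s)) f) (Sum.elim (fun _ => univ) D))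
      (Finset.univ.image T)) ≤ Fintype.card G * (2 * ∑ k, μ (D k)) := by
  classical
  have himgm : ∀ k, MeasurableSet (f k '' D k) := fun k =>
    (h k).measurableSet_image (h k).measurableSet le_rfl
  have hTμ : ∀ s E, MeasurableSet E → μ (T s ⁻¹' E) = μ E := by
    intro s E hE
    have hp : IsPartial R (T s) univ :=
      ⟨(T s).measurable, .univ, (T s).injective.injOn, fun x _ => hTR s x⟩
    rw [← hp.measure_image hII ((T s).measurable hE) (subset_univ _),
      image_preimage_eq _ (T s).surjective]
  have hpt : ∀ x, ((({e ∈ edgeBoundary R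
      (graphUnion (Sum.elim (fun s => ⇑(T s)) f) (Sum.elim (fun _ => univ) D))
      (Finset.univ.image T) | e.1.1 = x}.encard : ℕ∞) : ℝ≥0∞)) ≤
      ∑ j : G × κ, ((T j.1 ⁻¹' D j.2).indicator 1 x + (T j.1 ⁻¹' (f j.2 '' D j.2)).indicator 1 x) := by
    intro x
    -- In the fibre over `x`, `P` collects the edges of the `f k` that start at an orbit point and
    -- `Q` those that end at one. Each set has at most one element, and the two together account for
    -- the factor `2`.
    let P : G × κ → Set ((X × X) × (X × X)) := fun j =>
      {e | T j.1 x ∈ D j.2 ∧ e = ((x, T j.1 x), (x, f j.2 (T j.1 x)))}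
    let Q : G × κ → Set ((X × X) × (X × X)) := fun j =>
      {e | ∃ y ∈ D j.2, f j.2 y = T j.1 x ∧ e = ((x, y), (x, T j.1 x))}
    have hsub : {e ∈ edgeBoundary R
        (graphUnion (Sum.elim (fun s => ⇑(T s)) f) (Sum.elim (fun _ => univ) D))
        (Finset.univ.image T) | e.1.1 = x} ⊆ ⋃ j, (P j ∪ Q j) := by
      rintro ⟨⟨x', y⟩, ⟨x'', z⟩⟩ ⟨⟨⟨hxx, -, -, i, hi⟩, hxor⟩, hx⟩
      obtain rfl : x' = x'' := hxx
      obtain rfl : x' = x := hx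
      simp only [vertexSet, Finset.mem_image, Finset.mem_univ, true_and, mem_ofPred_eq,
        exists_exists_eq_and] at hxor
      -- An edge of the action joins two points of the same orbit and is never in the boundary.
      rcases i with s | k
      · obtain rfl : z = T s y := hi.2
        exfalso
        rcases hxor with ⟨⟨t, rfl⟩, h2⟩ | ⟨⟨t, ht⟩, h2⟩
        · exact h2 ⟨s + t, hTadd s t x'⟩
        · refine h2 ⟨-s + t, (T s).injective ?_⟩
          rw [hTadd, ht, add_neg_cancel_left]
      · obtain rfl : z = f k y := hi.2
        have hy : y ∈ D k := hi.1
        rcases hxor with ⟨⟨t, rfl⟩, -⟩ | ⟨⟨t, ht⟩, -⟩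
        · exact mem_iUnion.2 ⟨(t, k), Or.inl ⟨hy, rfl⟩⟩
        · exact mem_iUnion.2 ⟨(t, k), Or.inr ⟨y, hy, ht, by rw [ht]⟩⟩
    have hP : ∀ j, ((P j).encard : ℝ≥0∞) ≤ (T j.1 ⁻¹' D j.2).indicator 1 x := by
      intro j
      by_cases hj : T j.1 x ∈ D j.2
      · rw [indicator_of_mem (by exact hj)]
        have hle : (P j).encard ≤ 1 := encard_le_one_iff.2 fun a b ha hb => ha.2.trans hb.2.symm
        exact (ENat.toENNReal_le.2 hle).trans_eq (by simp)
      · have : P j = ∅ := eq_empty_of_forall_notMem fun e he => hj he.1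
        simp [this]
    have hQ : ∀ j, ((Q j).encard : ℝ≥0∞) ≤ (T j.1 ⁻¹' (f j.2 '' D j.2)).indicator 1 x := by
      intro j
      by_cases hj : T j.1 x ∈ f j.2 '' D j.2
      · rw [indicator_of_mem (by exact hj)]
        have hle : (Q j).encard ≤ 1 := by
          refine encard_le_one_iff.2 ?_
          rintro _ _ ⟨y, hy, hy', rfl⟩ ⟨z, hz, hz', rfl⟩
          rw [(h j.2).injOn hy hz (hy'.trans hz'.symm)]
        exact (ENat.toENNReal_le.2 hle).trans_eq (by simp)
      · have : Q j = ∅ := eq_empty_of_forall_notMem fun e ⟨y, hy, hy', _⟩ => hj ⟨y, hy, hy'⟩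
        simp [this]
    have h1 := (encard_le_encard hsub).trans (encard_iUnion_le_of_fintype _)
    have h2 := h1.trans (Finset.sum_le_sum fun j _ => encard_union_le (P j) (Q j))
    have h3 := ENat.toENNReal_le.2 h2
    refine h3.trans ?_
    change ENat.toENNRealRingHom _ ≤ _
    rw [map_sum]
    refine Finset.sum_le_sum fun j _ => ?_
    rw [map_add]
    exact add_le_add (hP j) (hQ j)
  refine (lintegral_mono hpt).trans ?_
  have hD : ∀ k, MeasurableSet (D k) := fun k => (h k).measurableSet
  have hm1 : ∀ j : G × κ, Measurable ((T j.1 ⁻¹' D j.2).indicator (1 : X → ℝ≥0∞)) := fun j =>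
    measurable_one.indicator ((T j.1).measurable (hD j.2))
  have hm2 : ∀ j : G × κ, Measurable ((T j.1 ⁻¹' (f j.2 '' D j.2)).indicator (1 : X → ℝ≥0∞)) :=
    fun j => measurable_one.indicator ((T j.1).measurable (himgm j.2))
  rw [lintegral_finsetSum (f := fun (j : G × κ) (x : X) => (T j.1 ⁻¹' D j.2).indicator 1 x +
    (T j.1 ⁻¹' (f j.2 '' D j.2)).indicator 1 x) _ fun j _ => (hm1 j).add (hm2 j)]
  have hint : ∀ j : G × κ, ∫⁻ x, ((T j.1 ⁻¹' D j.2).indicator 1 x +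
      (T j.1 ⁻¹' (f j.2 '' D j.2)).indicator 1 x) ∂μ = 2 * μ (D j.2) := by
    intro j
    rw [lintegral_add_left (hm1 j), lintegral_indicator_one ((T j.1).measurable (hD j.2)),
      lintegral_indicator_one ((T j.1).measurable (himgm j.2)), hTμ _ _ (hD j.2),
      hTμ _ _ (himgm j.2), (h j.2).measure_image hII (hD j.2) le_rfl, two_mul]
  rw [Finset.sum_congr rfl fun j _ => hint j, Fintype.sum_prod_type]
  simp [Finset.mul_sum]

/-! ### Construction of the finite graphing. -/

/-- From a graphing family, a finite graphing and a symmetric family whose boundary is controlled by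
the excess of the cost of the family. -/
lemma IsGraphingFamily.exists_uniformIsoperimetricConstant_le {R : Setoid X} {μ : Measure X}
    [IsProbabilityMeasure μ] [NullSingletonClass μ] (hR : IsMeasured R μ) (hII : IsTypeII1 R μ)
    (herg : IsErgodic R μ) {Φ : ℕ → PartialAut R} (hΦ : IsGraphingFamily R μ Φ) {N : ℕ}
    (hN : 2 ≤ N) {m : ℝ≥0∞} (hm : m ≤ 1) (hΦm : familyCost μ Φ + (N : ℝ≥0∞)⁻¹ ≤ 1 + m) :
    uniformIsoperimetricConstant R μ ≤ 4 * m := by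
  classical
  have : NeZero N := ⟨by omega⟩
  have hN0 : (N : ℝ≥0∞) ≠ 0 := by simpa using NeZero.ne N
  obtain ⟨F, C, hF, hCdom, hedge⟩ := exists_doubled Φ
  have hgenΦ : ∀ᵐ x ∂μ, ∀ y, R.r x y → Relation.EqvGen (doubledEdge F C) x y := by
    have h := hΦ.generates
    simp only [hedge] at h
    exact h
  obtain ⟨g, Cg, S, hc, hS⟩ := hF.exists_cover hR hgenΦ
  obtain ⟨A, T, hA, hμA, hTR, hTadd, hTne, hTA⟩ := hc.exists_action hII herg N hN
  obtain ⟨r, B, U, hr, hB, hAB, hBmem, hrA, hrR, hrfix, hU, hUr, hUcost⟩ :=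
    hF.exists_contraction hII hA
  have hBconull : ∀ᵐ x ∂μ, x ∈ B := by
    have hA0 : μ A ≠ 0 := by simp [hμA]
    have hSae : ∀ᵐ x ∂μ, x ∈ S := hc.conull
    filter_upwards [hc.ae_exists_rel herg hA hA0, hSae] with x ⟨a, ha, hxa⟩ hx
    exact hBmem x a ha (hS x hx a hxa)
  have hBA : μ (B \ A) + (N : ℝ≥0∞)⁻¹ = 1 := by
    have h1 : μ B = 1 := prob_compl_eq_zero_iff hB |>.1 hBconull
    rw [← h1, ← measure_sdiff_add_inter (μ := μ) B hA, inter_eq_right.2 hAB, hμA]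
  -- The surplus is the cost minus the measure `1 - 1/N` of the forest, written additively to avoid
  -- subtraction in `ℝ≥0∞`.
  have hDcost : ∑' i, μ (C (i, true) \ U i) ≤ m := by
    have h1 : ∑' i, μ (C (i, true)) = familyCost μ Φ := tsum_congr fun i => by rw [hCdom]
    have h2 : ∑' i, μ (C (i, true) \ U i) + 1 ≤ m + 1 := by
      rw [← hBA, ← add_assoc, hUcost, h1, hBA, add_comm m]
      exact hΦm
    exact (ENNReal.add_le_add_iff_right ENNReal.one_ne_top).1 h2
  -- the edges out of the forest are packed into `X`
  let D : ℕ → Set X := fun i => (C (i, true) \ U i) ∩ S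
  have hDm : ∀ i, MeasurableSet (D i) := fun i =>
    ((hF.isPartial _).measurableSet.diff (hU i)).inter hc.measurableSet
  have hDm' : ∑' i, μ (D i) ≤ m :=
    (ENNReal.tsum_le_tsum fun i => measure_mono inter_subset_left).trans hDcost
  obtain ⟨p, D', hp, hD'D, hD'0, -, hpd⟩ := hc.exists_packing hII herg hDm (Q := univ) .univ
    (by simpa using hDm'.trans hm)
  let P : Set X := ⋃ i, p i '' D' i
  have himgm : ∀ i, MeasurableSet (p i '' D' i) := fun i =>
    (hp i).measurableSet_image (hp i).measurableSet le_rfl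
  have hPm : MeasurableSet P := MeasurableSet.iUnion himgm
  have hPS : P ⊆ S := by
    rintro _ hy
    obtain ⟨i, x, hx, rfl⟩ := mem_iUnion.1 hy
    exact hc.saturated x (hD'D i hx).2 _ ((hp i).rel x hx)
  have hPμ : μ P ≤ m := by
    refine (measure_iUnion_le _).trans (le_trans (ENNReal.tsum_le_tsum fun i => ?_) hDm')
    rw [(hp i).measure_image hII (hp i).measurableSet le_rfl]
    exact measure_mono (hD'D i)
  choose p' hp'm hp' using fun i => (hp i).exists_inverse
  obtain ⟨j, hjm, hj⟩ := exists_measurable_index (fun i => p i '' D' i) himgm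
  have hjp : ∀ i, ∀ x ∈ D' i, j (p i x) = i := by
    intro i x hx
    by_contra hne
    have h1 : p i x ∈ p i '' D' i := mem_image_of_mem _ hx
    exact disjoint_left.1 (hpd hne) (hj _ i h1) h1
  -- A point of `P` stands for one surplus edge; `q₁` and `q₂` give the retractions of its two
  -- endpoints.
  let q₁ : X → X := fun y => r (p' (j y) y)
  let q₂ : X → X := fun y => r (F (j y, true) (p' (j y) y))
  have hq₁ : ∀ i, ∀ x ∈ D' i, q₁ (p i x) = r x := by
    intro i x hx
    simp only [q₁, hjp i x hx, hp' i x hx]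
  have hq₂ : ∀ i, ∀ x ∈ D' i, q₂ (p i x) = r (F (i, true) x) := by
    intro i x hx
    simp only [q₂, hjp i x hx, hp' i x hx]
  have hq₁m : Measurable q₁ := hr.comp (measurable_apply_index hp'm hjm)
  have hq₂m : Measurable q₂ := hr.comp (measurable_apply_index
    (g := fun i y => F (i, true) (p' i y))
    (fun i => (hF.isPartial _).measurable.comp (hp'm i)) hjm)
  have hq₁R : ∀ y ∈ P, R.r y (q₁ y) := by
    intro y hy
    obtain ⟨i, x, hx, rfl⟩ := mem_iUnion.1 hy
    rw [hq₁ i x hx]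
    exact R.trans (R.symm ((hp i).rel x hx)) (hrR x)
  have hq₂R : ∀ y ∈ P, R.r y (q₂ y) := by
    intro y hy
    obtain ⟨i, x, hx, rfl⟩ := mem_iUnion.1 hy
    rw [hq₂ i x hx]
    exact R.trans (R.symm ((hp i).rel x hx))
      (R.trans ((hF.isPartial (i, true)).rel x (hD'D i hx).1.1) (hrR _))
  obtain ⟨σ₁, P₁, hP₁, hσ₁, hτ₁, hgen₁⟩ := hc.exists_chain hPm hPS hq₁m hq₁R
  obtain ⟨σ₂, P₂, hP₂, hσ₂, hτ₂, hgen₂⟩ := hc.exists_chain hPm hPS hq₂m hq₂R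
  let f : Fin 4 → X → X := ![σ₁, q₁, σ₂, q₂]
  let E : Fin 4 → Set X := ![P₁, P \ P₁, P₂, P \ P₂]
  have hfE : ∀ k, IsPartial R (f k) (E k) := by
    intro k
    fin_cases k
    exacts [hσ₁, hτ₁, hσ₂, hτ₂]
  have hEμ : ∑ k, μ (E k) ≤ 2 * m := by
    have h1 : μ P₁ + μ (P \ P₁) = μ P := by
      rw [← measure_sdiff_add_inter (μ := μ) P hσ₁.measurableSet, inter_eq_right.2 hP₁, add_comm]
    have h2 : μ P₂ + μ (P \ P₂) = μ P := by
      rw [← measure_sdiff_add_inter (μ := μ) P hσ₂.measurableSet, inter_eq_right.2 hP₂, add_comm]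
    calc ∑ k, μ (E k) = (μ P₁ + μ (P \ P₁)) + (μ P₂ + μ (P \ P₂)) := by
          simp [Fin.sum_univ_four, E, add_assoc]
      _ = 2 * μ P := by rw [h1, h2, two_mul]
      _ ≤ 2 * m := by gcongr
  let K : Set (X × X) :=
    graphUnion (Sum.elim (fun s => ⇑(T s)) f) (Sum.elim (fun _ : ZMod N => univ) E)
  have hKT : ∀ s x, (x, T s x) ∈ K := fun s x => ⟨Sum.inl s, mem_univ _, rfl⟩
  have hKf : ∀ k, ∀ x ∈ E k, (x, f k x) ∈ K := fun k x hx => ⟨Sum.inr k, hx, rfl⟩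
  have hK₁ : ∀ x ∈ P, Relation.EqvGen (fun a b => (a, b) ∈ K) x (q₁ x) := fun x hx =>
    (hgen₁ x hx).mono (by
      rintro a b (⟨ha, rfl⟩ | ⟨ha, rfl⟩)
      exacts [hKf 0 a ha, hKf 1 a ha])
  have hK₂ : ∀ x ∈ P, Relation.EqvGen (fun a b => (a, b) ∈ K) x (q₂ x) := fun x hx =>
    (hgen₂ x hx).mono (by
      rintro a b (⟨ha, rfl⟩ | ⟨ha, rfl⟩)
      exacts [hKf 2 a ha, hKf 3 a ha])
  have hKfin : IsFiniteGraphing R μ K := by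
    refine isFiniteGraphing_graphUnion ?_ ?_
    · rintro (s | k)
      · exact ⟨(T s).measurable, .univ, (T s).injective.injOn, fun x _ => hTR s x⟩
      · exact hfE k
    · let M : Set X := (Sᶜ ∪ {x | ¬ ∃ s, T s x ∈ A}) ∪ ⋃ i, D i \ D' i
      have hM : μ M = 0 := measure_union_null (measure_union_null hc.conull hTA)
        (measure_iUnion_null hD'0)
      have hMae : ∀ᵐ x ∂μ, x ∉ {y | ∃ x ∈ M, R.r x y} :=
        measure_eq_zero_iff_ae_notMem.1 (hR.null_saturation M hM)
      filter_upwards [hMae] with x hx y hxy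
      have hgood : ∀ z, R.r x z → z ∈ S ∧ (∃ s, T s z ∈ A) ∧ ∀ i, z ∈ D i → z ∈ D' i := by
        intro z hz
        have hzM : z ∉ M := fun h => hx ⟨z, h, R.symm hz⟩
        refine ⟨?_, ?_, ?_⟩
        · by_contra hcon
          exact hzM (Or.inl (Or.inl hcon))
        · by_contra hcon
          exact hzM (Or.inl (Or.inr hcon))
        · intro i hi
          by_contra hcon
          exact hzM (Or.inr (mem_iUnion.2 ⟨i, hi, hcon⟩))
      -- After retraction a forest edge collapses to a point, and a surplus edge is crossed through
      -- its representative in `P`. Equivalence is carried along in the induction to keep the chain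
      -- in the class of `x`.
      have hstep : ∀ a b, Relation.EqvGen (doubledEdge F C) a b → R.r a b ∧
          (R.r x a → Relation.EqvGen (fun a b => (a, b) ∈ K) (r a) (r b)) := by
        intro a b hab
        induction hab with
        | rel a b h =>
          obtain ⟨i, hi, rfl⟩ := h
          refine ⟨(hF.isPartial _).rel a hi, fun hxa => ?_⟩
          by_cases hiU : a ∈ U i
          · rw [hUr i a hiU]
            exact .refl _
          · obtain ⟨haS, -, haD⟩ := hgood a hxa
            have haD' : a ∈ D' i := haD i ⟨⟨hi, hiU⟩, haS⟩
            have haP : p i a ∈ P := mem_iUnion.2 ⟨i, mem_image_of_mem _ haD'⟩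
            rw [← hq₁ i a haD', ← hq₂ i a haD']
            exact .trans _ _ _ (.symm _ _ (hK₁ _ haP)) (hK₂ _ haP)
        | refl a => exact ⟨R.refl a, fun _ => .refl _⟩
        | symm a b _ ih =>
          exact ⟨R.symm ih.1, fun hxb => .symm _ _ (ih.2 (R.trans hxb (R.symm ih.1)))⟩
        | trans a b c _ _ ih₁ ih₂ =>
          exact ⟨R.trans ih₁.1 ih₂.1,
            fun hxa => .trans _ _ _ (ih₁.2 hxa) (ih₂.2 (R.trans hxa ih₁.1))⟩
      -- The action brings `x` and `y` into `A`, where the retraction is the identity and `hstep`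
      -- connects them.
      obtain ⟨-, ⟨s, hs⟩, -⟩ := hgood x (R.refl x)
      obtain ⟨-, ⟨t, ht⟩, -⟩ := hgood y hxy
      have hxs : R.r x (T s x) := hTR s x
      have hst : R.r (T s x) (T t y) := R.trans (R.symm hxs) (R.trans hxy (hTR t y))
      have h1 := (hstep _ _ (hS _ (hgood _ hxs).1 _ hst)).2 hxs
      rw [hrfix _ hs, hrfix _ ht] at h1
      exact .trans _ _ _ (.rel _ _ (hKT s x)) (.trans _ _ _ h1 (.symm _ _ (.rel _ _ (hKT t y))))
  have hTinj : Function.Injective T := by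
    intro s t hst
    by_contra hne
    have h := hTne s t hne
    simp only [hst, ne_eq, not_true_eq_false, Filter.eventually_false_iff_eq_bot, ae_eq_bot] at h
    exact IsProbabilityMeasure.ne_zero μ h
  have hsym : IsSymmetricFamily R μ (Finset.univ.image T) := by
    refine ⟨⟨T 0, by simp⟩, ?_, ?_⟩
    · intro φ hφ
      obtain ⟨s, -, rfl⟩ := Finset.mem_image.1 hφ
      exact hTR s
    · intro φ hφ ψ hψ hne
      obtain ⟨s, -, rfl⟩ := Finset.mem_image.1 hφ
      obtain ⟨t, -, rfl⟩ := Finset.mem_image.1 hψ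
      exact hTne s t fun h => hne (by rw [h])
  have hcard : (Finset.univ.image T).card = N := by
    rw [Finset.card_image_of_injective _ hTinj, Finset.card_univ, ZMod.card]
  refine (iInf₂_le K hKfin).trans ((iInf₂_le (Finset.univ.image T) hsym).trans ?_)
  rw [hcard]
  refine ENNReal.div_le_of_le_mul ?_
  refine (edgeMeasure_edgeBoundary_le hII T hTR hTadd hfE).trans ?_
  rw [ZMod.card, mul_comm]
  gcongr ?_ * _
  calc 2 * ∑ k, μ (E k) ≤ 2 * (2 * m) := by gcongr
    _ = 4 * m := by rw [← mul_assoc]; norm_num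

end

end MeasuredEqRel

theorem mainTheorem5 {X : Type*} [MeasurableSpace X] [StandardBorelSpace X]
    (μ : Measure X) [IsProbabilityMeasure μ] [NullSingletonClass μ] (R : Setoid X)
    (hR : MeasuredEqRel.IsMeasured R μ) (hII : MeasuredEqRel.IsTypeII1 R μ)
    (herg : MeasuredEqRel.IsErgodic R μ) (hcost : MeasuredEqRel.cost R μ = 1) :
    MeasuredEqRel.uniformIsoperimetricConstant R μ = 0 := by
  -- Here `m = 2 * δ`, one `δ` for the excess cost and one for `1/N`; the bound on `δ` gives `m ≤
  -- 1`, so that the surplus fits into `X`.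
  have key : ∀ δ : ℝ≥0∞, 0 < δ → δ ≤ 2⁻¹ →
      MeasuredEqRel.uniformIsoperimetricConstant R μ ≤ 8 * δ := by
    intro δ hδ hδ1
    have hlt : MeasuredEqRel.cost R μ < 1 + δ := by
      rw [hcost]
      exact ENNReal.lt_add_right ENNReal.one_ne_top hδ.ne'
    obtain ⟨Φ, hΦ, hΦc⟩ : ∃ Φ, ∃ _ : MeasuredEqRel.IsGraphingFamily R μ Φ,
        MeasuredEqRel.familyCost μ Φ < 1 + δ := by
      simpa only [MeasuredEqRel.cost, iInf_lt_iff] using hlt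
    obtain ⟨n, hn⟩ := ENNReal.exists_inv_nat_lt hδ.ne'
    have hN : ((n + 2 : ℕ) : ℝ≥0∞)⁻¹ ≤ δ := by
      refine le_trans (ENNReal.inv_le_inv.2 ?_) hn.le
      exact_mod_cast Nat.le_add_right n 2
    have h := hΦ.exists_uniformIsoperimetricConstant_le hR hII herg (N := n + 2) (by omega)
      (m := 2 * δ) (by
        calc 2 * δ ≤ 2 * 2⁻¹ := by gcongr
          _ = 1 := ENNReal.mul_inv_cancel (by norm_num) (by norm_num))
      (by
        calc _ ≤ (1 + δ) + δ := add_le_add hΦc.le hN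
          _ = 1 + 2 * δ := by rw [add_assoc, two_mul])
    refine h.trans_eq ?_
    rw [← mul_assoc]
    norm_num
  refine le_antisymm (ENNReal.le_of_forall_pos_le_add fun ε hε _ => ?_) zero_le
  rw [zero_add]
  have h8 : (8 : ℝ≥0∞) ≠ 0 := by norm_num
  have h8' : (8 : ℝ≥0∞) ≠ ∞ := by norm_num
  have hε' : (0 : ℝ≥0∞) < ε / 8 :=
    ENNReal.div_pos (by simpa using hε.ne') h8'
  refine (key (min (ε / 8) 2⁻¹) (lt_min hε' (by simp)) (min_le_right _ _)).trans ?_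
  calc (8 : ℝ≥0∞) * min ((ε : ℝ≥0∞) / 8) 2⁻¹ ≤ 8 * (ε / 8) := by gcongr; exact min_le_left _ _
    _ = ε := ENNReal.mul_div_cancel h8 h8'
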